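/- Throughout, a self-similar measure on $\mathbb{R}$ is a Borel probability measure $\mu$ such that $\mu=\sum_{i=1}^N p_i\,(f_i)_*\mu$ for some integer $N>1$, weights $p_i\in(0,1)$ with $\sum_i p_i=1$, and contracting similarities $f_i(x)=a_ix+t_i$ of $\mathbb{R}$ ($0<|a_i|<1$, $t_i\in\mathbb{R}$) that have no common fixed point; no separation condition is assumed. Such a measure is carried by the attractor of $\{f_i\}$, i.e. the unique non-empty compact set $K$ with $K=\bigcup_i f_i(K)$. A Borel probability measure $\mu$ on $\mathbb{R}$ with compact support is AD-regular if there are $s\ge 0$ and $C\ge 1$ such that $C^{-1}r^s\le\mu(B_r(x))\le Cr^s$ for all $x\in\operatorname{supp}\mu$ and all $0<r\le 1$. With $\widehat\mu(\xi)=\int e^{-2\pi i x\xi}\,d\mu(x)$, put $$\kappa_2(\mu)=\sup\Big\{0\le s<1:\ \exists C>0\ \ \forall R>0\quad \int_{|\xi|<R}|\widehat\mu(\xi)|^2\,d\xi\le C R^{1-s}\Big\}.$$ The multiplicative convolutions $\mu\cdot\nu$ and $\mu\cdot\nu\cdot\gamma$ are the pushforwards of the product measures $\mu\times\nu$ and $\mu\times\nu\times\gamma$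 under $(x,y)\mapsto xy$ and $(x,y,z)\mapsto xyz$ respectively. **Theorem.** Let $\mu,\nu,\gamma$ be AD-regular self-similar measures on $\mathbb{R}$ whose supports are contained in $(0,\infty)$. - If $\kappa_2(\mu)\kappa_2(\nu)+\max\{1.5\,\kappa_2(\mu)+\kappa_2(\nu),\ 1.5\,\kappa_2(\nu)+\kappa_2(\mu)\}>2.5$, then $\mu\cdot\nu$ is absolutely continuous with respect to Lebesgue measure on $\mathbb{R}$ with a density in $L^2(\mathbb{R})$. - If $\dfrac{\kappa_2(\mu)}2+\dfrac{\kappa_2(\nu)}2+\dfrac{\kappa_2(\gamma)-0.5}{\kappa_2(\gamma)+1.5}>1$, then $\mu\cdot\nu\cdot\gamma$ is absolutely continuous with respect to Lebesgue measure on $\mathbb{R}$ with a continuous density. -/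

import Mathlib

open MeasureTheory

/-- The Fourier transform `ξ ↦ ∫ e^{-2πixξ} dμ(x)` of a measure on the line. -/
noncomputable def measureFourier (μ : Measure ℝ) (ξ : ℝ) : ℂ :=
  ∫ x, Complex.exp (-2 * Real.pi * Complex.I * ξ * x) ∂μ

/-- The Fourier `l^p` dimension `κ_p` of a measure on the line: the supremum of the `s ∈ [0, 1)`
with `∫_{B(0,R)} |μ̂|^p ≤ C R^{1-s}` for some constant `C` and all `R > 0`. The set contains `0`
and is bounded above by `1` for finite measures, so the real supremum is a genuine one. -/
noncomputable def fourierDim (p : ℝ) (μ : Measure ℝ) : ℝ :=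
  sSup {s : ℝ | 0 ≤ s ∧ s < 1 ∧ ∃ C : ℝ, ∀ R : ℝ, 0 < R →
    ∫ ξ in Metric.ball (0 : ℝ) R, ‖measureFourier μ ξ‖ ^ p ≤ C * R ^ (1 - s)}

/-- The correlation (Fourier `l²`) dimension. -/
noncomputable def kappaTwo (μ : Measure ℝ) : ℝ := fourierDim 2 μ

/-- Ahlfors--David regularity: for some `s ≥ 0` and `C ≥ 1`, balls of radius `r ∈ (0, 1]` centred
in the support have measure between `C⁻¹ r^s` and `C r^s`. For a probability measure with bounded
support, replacing `1` by any other positive upper bound on the radii gives the same notion. -/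
def IsADRegular (μ : Measure ℝ) : Prop :=
  ∃ s C : ℝ, 0 ≤ s ∧ 1 ≤ C ∧ ∀ x ∈ μ.support, ∀ r : ℝ, 0 < r → r ≤ 1 →
    C⁻¹ * r ^ s ≤ μ.real (Metric.ball x r) ∧ μ.real (Metric.ball x r) ≤ C * r ^ s

/-- Self-similar measures on the line: the Borel probability measure `μ` carried by the attractor
`K` of an iterated function system of `N > 1` contracting similarities `x ↦ a i * x + t i`
(contraction ratio `|a i|`, reflections allowed) without a common fixed point, with
`μ = ∑ p i • (f i)_* μ` for weights `p i ∈ (0, 1)` of sum `1`. No separation is assumed. -/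
def IsSelfSimilarMeasure (μ : Measure ℝ) : Prop :=
  IsProbabilityMeasure μ ∧
  ∃ (N : ℕ) (a t p : Fin N → ℝ) (K : Set ℝ),
    1 < N ∧
    (∀ i, 0 < |a i| ∧ |a i| < 1) ∧
    (¬ ∃ x : ℝ, ∀ i, a i * x + t i = x) ∧
    (∀ i, 0 < p i ∧ p i < 1) ∧
    ∑ i, p i = 1 ∧
    IsCompact K ∧ K.Nonempty ∧
    K = ⋃ i, (fun x : ℝ => a i * x + t i) '' K ∧
    μ Kᶜ = 0 ∧
    μ = ∑ i, ENNReal.ofReal (p i) • μ.map (fun x : ℝ => a i * x + t i)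

/-! In logarithmic coordinates multiplicative convolution becomes additive, so the Fourier transform
of the law of the logarithm of a product is the product of the transforms of the log-measures. It
suffices to show that this product lies in `L²` (two factors) or in `L¹` (three factors), invert,
and change variables back by `exp`.

Two estimates feed this. The first is an average one: an AD-regular measure satisfies `μ(B_r) ≤ C
r^κ` with `κ = κ₂(μ)` (`IsADRegular.exists_massBound`); this bound survives the logarithm and gives
`∫_{|ξ|<R} |·|² ≲ R^(1-κ)` for the transform of the log-measure.

The second is pointwise: the transform of `log_* μ` is `O(|ξ|^(-τ))` whenever `0 < τ < (κ - 1/2)/(κ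
+ 3/2)`. Cut `μ` into affine copies of ratio at most `r` (comparable to `r` from below), and
linearise `log` on each at a cost `|ξ| r²`. There remains an average of `|μ̂(η_j)|` over frequencies
`η_j = ξ b_j / y_j` of size at most about `|ξ| r`. Cauchy–Schwarz and a large-sieve inequality bound
its square by `(|ξ| r)^(1-κ)` times the largest weight of frequencies in a short window. The ratios
`b_j` are products of powers of finitely many numbers, so they take only polynomially many values in
the depth `L`; for a fixed ratio, close frequencies force close positions `y_j`, and the mass bound
gives weight `(|ξ| r)^(-κ)`. Choosing `r = |ξ|^(-(1+τ)/2)` balances the two errors.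

For two factors, pointwise decay of one and average decay of the other suffice when `2τ > 1 - κ`;
for three, two average bounds and one pointwise bound suffice when `τ > 1 - κ₂(μ)/2 - κ₂(ν)/2`.
These are the two numerical hypotheses. -/

open scoped FourierTransform ENNReal Topology SchwartzMap
open Filter

/-! ### Fourier duality and the Gaussian form of the `L²` energy. -/

section MeasureFourier

theorem measureFourier_eq_charFun (μ : Measure ℝ) (ξ : ℝ) :
    measureFourier μ ξ = charFun μ (-2 * Real.pi * ξ) := by
  rw [charFun_apply_real, measureFourier]
  congr 1; ext x; congr 1; push_cast; ring

theorem continuous_measureFourier (μ : Measure ℝ) [IsFiniteMeasure μ] :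
    Continuous (measureFourier μ) := by
  have h : measureFourier μ = fun ξ => charFun μ (-2 * Real.pi * ξ) :=
    funext (measureFourier_eq_charFun μ)
  rw [h]
  exact continuous_charFun.comp (by fun_prop)

theorem norm_measureFourier_le (μ : Measure ℝ) (ξ : ℝ) :
    ‖measureFourier μ ξ‖ ≤ μ.real Set.univ := by
  rw [measureFourier_eq_charFun]; exact norm_charFun_le _

theorem norm_exp_measureFourier (ξ x : ℝ) :
    ‖Complex.exp (-2 * Real.pi * Complex.I * ξ * x)‖ = 1 := by
  have : (-2 * Real.pi * Complex.I * ξ * x : ℂ) = ((-2 * Real.pi * ξ * x : ℝ) : ℂ) * Complex.I := by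
    push_cast; ring
  rw [this, Complex.norm_exp_ofReal_mul_I]

/-- Fubini. It is applied to Gaussians, to indicators of intervals and to Schwartz functions. -/
theorem integral_measureFourier_mul (μ : Measure ℝ) [IsFiniteMeasure μ] {g : ℝ → ℂ}
    (hg : Integrable g) : ∫ ξ, measureFourier μ ξ * g ξ = ∫ x, 𝓕 g x ∂μ := by
  have h1 : ∀ x, 𝓕 g x = ∫ ξ : ℝ, Complex.exp (-2 * Real.pi * Complex.I * ξ * x) * g ξ := by
    intro x
    rw [Real.fourier_eq']
    congr 1; ext ξ
    rw [smul_eq_mul]; congr 2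
    simp; ring
  simp_rw [h1, measureFourier, ← integral_mul_const]
  rw [integral_integral_swap]
  refine Integrable.mono (g := fun z : ℝ × ℝ => g z.1 * (1 : ℂ)) (hg.mul_prod (integrable_const _))
    ?_ ?_
  · refine AEStronglyMeasurable.mul ?_ ?_
    · exact Continuous.aestronglyMeasurable (by fun_prop)
    · exact hg.aestronglyMeasurable.comp_fst
  · filter_upwards with z
    simp only [Function.uncurry, norm_mul]
    rw [norm_exp_measureFourier]; simp

theorem measureFourier_map_sub_prod (μ : Measure ℝ) [IsFiniteMeasure μ] (ξ : ℝ) :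
    measureFourier ((μ.prod μ).map (fun z => z.1 - z.2)) ξ = ((‖measureFourier μ ξ‖ ^ 2 : ℝ) : ℂ) := by
  have h : ((‖measureFourier μ ξ‖ ^ 2 : ℝ) : ℂ)
      = measureFourier μ ξ * (starRingEnd ℂ) (measureFourier μ ξ) := by
    rw [Complex.mul_conj, Complex.normSq_eq_norm_sq]
  rw [h]
  unfold measureFourier
  rw [integral_map (by fun_prop) (Continuous.aestronglyMeasurable (by fun_prop)),
    ← integral_conj, ← integral_prod_mul]
  congr 1; ext z
  rw [← Complex.exp_conj, ← Complex.exp_add]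
  congr 1
  simp [Complex.conj_ofNat]
  ring

theorem fourier_gaussian_scaled {R : ℝ} (hR : 0 < R) (t : ℝ) :
    𝓕 (fun x : ℝ => ((Real.exp (-Real.pi * (x / R) ^ 2) : ℝ) : ℂ)) t
      = ((R * Real.exp (-Real.pi * (R * t) ^ 2) : ℝ) : ℂ) := by
  have hb : 0 < (((1 / R ^ 2 : ℝ) : ℂ)).re := by
    rw [Complex.ofReal_re]; positivity
  have h := fourier_gaussian_pi hb
  have h0 : (fun x : ℝ => ((Real.exp (-Real.pi * (x / R) ^ 2) : ℝ) : ℂ))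
      = fun x : ℝ => Complex.exp (-Real.pi * ((1 / R ^ 2 : ℝ) : ℂ) * x ^ 2) := by
    ext x; push_cast; congr 1; ring
  rw [h0, h]
  have h2 : (((1 / R ^ 2 : ℝ) : ℂ)) ^ (1 / 2 : ℂ) = ((1 / R : ℝ) : ℂ) := by
    rw [show (1 / 2 : ℂ) = ((1 / 2 : ℝ) : ℂ) by push_cast; rfl, ← Complex.ofReal_cpow (by positivity)]
    congr 1
    rw [← Real.sqrt_eq_rpow, show 1 / R ^ 2 = (1 / R) ^ 2 by ring, Real.sqrt_sq (by positivity)]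
  simp only [h2]
  have : (R : ℂ) ≠ 0 := by exact_mod_cast hR.ne'
  push_cast
  congr 1
  · field_simp
  · congr 1; field_simp

theorem integrable_gaussian_scaled {R : ℝ} (hR : 0 < R) :
    Integrable (fun x : ℝ => Real.exp (-Real.pi * (x / R) ^ 2)) := by
  have := integrable_exp_neg_mul_sq (b := Real.pi / R ^ 2) (by positivity)
  refine this.congr (ae_of_all _ fun x => ?_)
  simp only; congr 1; field_simp

theorem integral_norm_sq_measureFourier_mul_gaussian (μ : Measure ℝ) [IsFiniteMeasure μ] {R : ℝ}
    (hR : 0 < R) :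
    ∫ ξ, ‖measureFourier μ ξ‖ ^ 2 * Real.exp (-Real.pi * (ξ / R) ^ 2)
      = ∫ z, R * Real.exp (-Real.pi * (R * (z.1 - z.2)) ^ 2) ∂(μ.prod μ) := by
  have h := integral_measureFourier_mul ((μ.prod μ).map (fun z => z.1 - z.2))
    (integrable_gaussian_scaled hR).ofReal
  have h0 : ∀ t, 𝓕 (fun x : ℝ => (Complex.ofReal (Real.exp (-Real.pi * (x / R) ^ 2)))) t
      = ((R * Real.exp (-Real.pi * (R * t) ^ 2) : ℝ) : ℂ) := fourier_gaussian_scaled hR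
  erw [funext h0] at h
  simp_rw [measureFourier_map_sub_prod] at h
  rw [integral_map (by fun_prop) (Continuous.aestronglyMeasurable (by fun_prop))] at h
  have h' : ∫ ξ, Complex.ofReal (‖measureFourier μ ξ‖ ^ 2 * Real.exp (-Real.pi * (ξ / R) ^ 2))
      = ∫ z, Complex.ofReal (R * Real.exp (-Real.pi * (R * (z.1 - z.2)) ^ 2)) ∂(μ.prod μ) := by
    refine Eq.trans ?_ h
    congr 1; ext ξ
    exact Complex.ofReal_mul _ _
  rw [integral_complex_ofReal, integral_complex_ofReal] at h'
  exact Complex.ofReal_injective h'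

/-- Since `|μ̂|²` is the transform of the law of a difference of two independent points, duality
with a Gaussian yields an exact identity with positive terms on both sides. It therefore converts
mass bounds into energy bounds in either direction. -/
theorem lintegral_norm_sq_measureFourier_mul_gaussian (μ : Measure ℝ) [IsFiniteMeasure μ] {R : ℝ}
    (hR : 0 < R) :
    ∫⁻ ξ, ENNReal.ofReal (‖measureFourier μ ξ‖ ^ 2 * Real.exp (-Real.pi * (ξ / R) ^ 2))
      = ENNReal.ofReal R *
        ∫⁻ x, ∫⁻ y, ENNReal.ofReal (Real.exp (-Real.pi * (R * (y - x)) ^ 2)) ∂μ ∂μ := by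
  rw [← ofReal_integral_eq_lintegral_ofReal _ (ae_of_all _ fun _ => by positivity),
    integral_norm_sq_measureFourier_mul_gaussian μ hR, ofReal_integral_eq_lintegral_ofReal _
      (ae_of_all _ fun _ => by positivity),
    lintegral_prod _ (by fun_prop)]
  · rw [← lintegral_const_mul' _ _ (by simp)]
    congr 1; ext x
    rw [← lintegral_const_mul' _ _ (by simp)]
    congr 1; ext y
    rw [← ENNReal.ofReal_mul hR.le]
    congr 3; ring
  · refine Integrable.mono' (integrable_const R) (Continuous.aestronglyMeasurable (by fun_prop))
      (ae_of_all _ fun z => ?_)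
    rw [Real.norm_of_nonneg (by positivity)]
    refine mul_le_of_le_one_right hR.le (Real.exp_le_one_iff.2 ?_)
    have := Real.pi_pos
    nlinarith [sq_nonneg (R * (z.1 - z.2)), mul_nonneg this.le (sq_nonneg (R * (z.1 - z.2)))]
  · refine (integrable_gaussian_scaled hR).bdd_mul (c := μ.real Set.univ ^ 2) ?_ (ae_of_all _ fun x => ?_)
    · exact ((continuous_measureFourier μ).norm.pow 2).aestronglyMeasurable
    · rw [norm_pow, norm_norm]
      exact pow_le_pow_left₀ (norm_nonneg _) (norm_measureFourier_le μ x) 2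

end MeasureFourier

/-! ### Integrals of decaying weights against measures of power growth. -/

section PowerGrowth

theorem summable_gaussian_mul_pow (k : ℕ) :
    Summable fun n : ℕ => Real.exp (-Real.pi * (n : ℝ) ^ 2) * ((n : ℝ) + 1) ^ k := by
  have h := (Real.summable_pow_mul_exp_neg_nat_mul k (r := 1) one_pos)
  have h2 := ((summable_nat_add_iff 1).2 h).mul_left (Real.exp 1)
  refine Summable.of_nonneg_of_le (fun n => by positivity) (fun n => ?_) h2
  have : Real.exp (-Real.pi * (n : ℝ) ^ 2) ≤ Real.exp 1 * Real.exp (-1 * ((n + 1 : ℕ) : ℝ)) := by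
    rw [← Real.exp_add]
    apply Real.exp_le_exp.2
    push_cast
    have h3 := Real.pi_gt_three
    have h4 : (n : ℝ) ≤ (n : ℝ) ^ 2 := by exact_mod_cast Nat.le_self_pow (by norm_num) n
    nlinarith [(Nat.cast_nonneg n : (0 : ℝ) ≤ n)]
  calc _ ≤ (Real.exp 1 * Real.exp (-1 * ((n + 1 : ℕ) : ℝ))) * ((n : ℝ) + 1) ^ k := by gcongr
    _ = _ := by push_cast; ring

/-- Split into shells of width `R`: the Gaussian beats the growth `(n + 1)^t`. Because `K` depends
on `t` alone, the bound serves in physical space, uniformly in the centre, and in frequency space,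
for the density `|μ̂|²`. -/
theorem exists_lintegral_gaussian_le (t : ℝ) : ∃ K : ℝ, 0 ≤ K ∧
    ∀ (m : Measure ℝ) (C R : ℝ), 0 ≤ C → 0 < R →
      (∀ r, 0 < r → m (Metric.ball 0 r) ≤ ENNReal.ofReal (C * r ^ t)) →
      ∫⁻ x, ENNReal.ofReal (Real.exp (-Real.pi * (x / R) ^ 2)) ∂m
        ≤ ENNReal.ofReal (K * C * R ^ t) := by
  obtain ⟨k, hk⟩ := exists_nat_ge t
  set c : ℕ → ℝ := fun n => Real.exp (-Real.pi * (n : ℝ) ^ 2) * ((n : ℝ) + 1) ^ k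
  refine ⟨∑' n, c n, tsum_nonneg fun n => by positivity, fun m C R hC hR h => ?_⟩
  calc ∫⁻ x, ENNReal.ofReal (Real.exp (-Real.pi * (x / R) ^ 2)) ∂m
      ≤ ∫⁻ x, ∑' n : ℕ, (Metric.ball (0 : ℝ) ((n + 1) * R)).indicator
          (fun _ => ENNReal.ofReal (Real.exp (-Real.pi * (n : ℝ) ^ 2))) x ∂m := by
        apply lintegral_mono
        intro x
        refine le_trans ?_ (ENNReal.le_tsum ⌊|x| / R⌋₊)
        have h1 := Nat.lt_floor_add_one (|x| / R)
        have h2 := Nat.floor_le (a := |x| / R) (by positivity)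
        rw [div_lt_iff₀ hR] at h1
        rw [Set.indicator_of_mem (by rwa [mem_ball_zero_iff, Real.norm_eq_abs])]
        apply ENNReal.ofReal_le_ofReal
        apply Real.exp_le_exp.2
        have : (⌊|x| / R⌋₊ : ℝ) ^ 2 ≤ (x / R) ^ 2 := by
          rw [← sq_abs (x / R), abs_div, abs_of_pos hR]
          gcongr
        nlinarith [Real.pi_pos]
    _ = ∑' n : ℕ, ENNReal.ofReal (Real.exp (-Real.pi * (n : ℝ) ^ 2)) *
          m (Metric.ball (0 : ℝ) ((n + 1) * R)) := by
        rw [lintegral_tsum]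
        · congr 1; ext n
          rw [lintegral_indicator_const Metric.isOpen_ball.measurableSet]
        · intro n
          exact (measurable_const.indicator Metric.isOpen_ball.measurableSet).aemeasurable
    _ ≤ ∑' n : ℕ, ENNReal.ofReal (c n * (C * R ^ t)) := by
        refine ENNReal.tsum_le_tsum fun n => ?_
        refine (mul_le_mul_right (h _ (by positivity)) _).trans ?_
        rw [← ENNReal.ofReal_mul (by positivity)]
        apply ENNReal.ofReal_le_ofReal
        rw [Real.mul_rpow (by positivity) hR.le]
        have : ((n : ℝ) + 1) ^ t ≤ ((n : ℝ) + 1) ^ k := by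
          rw [← Real.rpow_natCast]
          exact Real.rpow_le_rpow_of_exponent_le (by linarith [(Nat.cast_nonneg n : (0 : ℝ) ≤ n)]) hk
        calc _ = Real.exp (-Real.pi * (n : ℝ) ^ 2) * (((n : ℝ) + 1) ^ t) * (C * R ^ t) := by ring
          _ ≤ _ := by simp only [c]; gcongr
    _ = ENNReal.ofReal ((∑' n, c n) * C * R ^ t) := by
        rw [← ENNReal.ofReal_tsum_of_nonneg (fun n => by positivity)
          ((summable_gaussian_mul_pow k).mul_right _), tsum_mul_right, mul_assoc]

/-- Dyadic shells give a geometric series of ratio `2^(t - q) < 1`. -/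
theorem lintegral_one_add_abs_rpow_lt_top {m : Measure ℝ} {C t q : ℝ} (hC : 0 ≤ C) (hq : 0 ≤ q)
    (htq : t < q) (h : ∀ r, 1 ≤ r → m (Metric.ball 0 r) ≤ ENNReal.ofReal (C * r ^ t)) :
    ∫⁻ x, ENNReal.ofReal ((1 + |x|) ^ (-q)) ∂m < ∞ := by
  have hρ : (2 : ℝ) ^ (t - q) < 1 := Real.rpow_lt_one_of_one_lt_of_neg (by norm_num) (by linarith)
  have hs : Summable fun n : ℕ => C * 2 ^ t * ((2 : ℝ) ^ (t - q)) ^ n :=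
    (summable_geometric_of_lt_one (by positivity) hρ).mul_left _
  calc ∫⁻ x, ENNReal.ofReal ((1 + |x|) ^ (-q)) ∂m
      ≤ ∫⁻ x, ∑' n : ℕ, (Metric.ball (0 : ℝ) (2 ^ (n + 1))).indicator
          (fun _ => ENNReal.ofReal (((2 : ℝ) ^ n) ^ (-q))) x ∂m := by
        apply lintegral_mono
        intro x
        obtain ⟨n, hn1, hn2⟩ := exists_nat_pow_near (x := 1 + |x|) (y := (2 : ℝ))
          (by linarith [abs_nonneg x]) (by norm_num)
        refine le_trans ?_ (ENNReal.le_tsum n)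
        rw [Set.indicator_of_mem (by rw [mem_ball_zero_iff, Real.norm_eq_abs]; linarith)]
        apply ENNReal.ofReal_le_ofReal
        exact Real.rpow_le_rpow_of_nonpos (by positivity) hn1 (by linarith)
    _ = ∑' n : ℕ, ENNReal.ofReal (((2 : ℝ) ^ n) ^ (-q)) * m (Metric.ball (0 : ℝ) (2 ^ (n + 1))) := by
        rw [lintegral_tsum]
        · congr 1; ext n
          rw [lintegral_indicator_const Metric.isOpen_ball.measurableSet]
        · intro n
          exact (measurable_const.indicator Metric.isOpen_ball.measurableSet).aemeasurable
    _ ≤ ∑' n : ℕ, ENNReal.ofReal (C * 2 ^ t * ((2 : ℝ) ^ (t - q)) ^ n) := by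
        refine ENNReal.tsum_le_tsum fun n => ?_
        refine (mul_le_mul_right (h _ (one_le_pow₀ (by norm_num))) _).trans ?_
        rw [← ENNReal.ofReal_mul (by positivity)]
        apply ENNReal.ofReal_le_ofReal
        apply le_of_eq
        simp only [← Real.rpow_natCast, ← Real.rpow_mul (zero_le_two : (0 : ℝ) ≤ 2)]
        push_cast
        rw [mul_left_comm, mul_assoc, ← Real.rpow_add two_pos, ← Real.rpow_add two_pos]
        congr 2; ring
    _ < ∞ := by
        rw [← ENNReal.ofReal_tsum_of_nonneg (fun n => by positivity) hs]
        exact ENNReal.ofReal_lt_top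

end PowerGrowth

/-! ### From uniform mass bounds to energy bounds. -/

section MassBound

/-- All balls of radius `r` have measure at most `C * r ^ s`. -/
def MassBound (μ : Measure ℝ) (s C : ℝ) : Prop :=
  ∀ x r : ℝ, 0 < r → μ (Metric.ball x r) ≤ ENNReal.ofReal (C * r ^ s)

theorem MassBound.exists_gaussian_energy_le {μ : Measure ℝ} [IsFiniteMeasure μ] {s C : ℝ}
    (hC : 0 ≤ C) (h : MassBound μ s C) : ∃ K : ℝ, 0 ≤ K ∧ ∀ R : ℝ, 0 < R →
      ∫⁻ ξ, ENNReal.ofReal (‖measureFourier μ ξ‖ ^ 2 * Real.exp (-Real.pi * (ξ / R) ^ 2))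
        ≤ ENNReal.ofReal (K * R ^ (1 - s)) := by
  obtain ⟨K, hK, H⟩ := exists_lintegral_gaussian_le s
  refine ⟨K * C * μ.real Set.univ, by positivity, fun R hR => ?_⟩
  have h1 : ∀ x, ∫⁻ y, ENNReal.ofReal (Real.exp (-Real.pi * (R * (y - x)) ^ 2)) ∂μ
      ≤ ENNReal.ofReal (K * C * R⁻¹ ^ s) := by
    intro x
    have h2 := H (μ.map (fun y => y - x)) C R⁻¹ hC (by positivity) (fun r hr => by
      rw [Measure.map_apply (by fun_prop) Metric.isOpen_ball.measurableSet]
      refine le_trans (measure_mono ?_) (h x r hr)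
      intro y hy
      simpa [Real.dist_eq] using hy)
    rw [lintegral_map (by fun_prop) (by fun_prop)] at h2
    refine le_trans (le_of_eq ?_) h2
    congr 1; ext y; congr 4; rw [div_inv_eq_mul]; ring
  rw [lintegral_norm_sq_measureFourier_mul_gaussian μ hR]
  calc _ ≤ ENNReal.ofReal R * ∫⁻ _, ENNReal.ofReal (K * C * R⁻¹ ^ s) ∂μ := by
        gcongr with x; exact h1 x
    _ = ENNReal.ofReal (K * C * μ.real Set.univ * R ^ (1 - s)) := by
        rw [lintegral_const, ← ofReal_measureReal, ← ENNReal.ofReal_mul (by positivity),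
          ← ENNReal.ofReal_mul hR.le]
        congr 1
        rw [Real.inv_rpow hR.le, Real.rpow_sub hR, Real.rpow_one]
        ring

theorem MassBound.exists_energy_le {μ : Measure ℝ} [IsFiniteMeasure μ] {s C : ℝ}
    (hC : 0 ≤ C) (h : MassBound μ s C) : ∃ K : ℝ, 0 ≤ K ∧ ∀ R : ℝ, 0 < R →
      ∫⁻ ξ in Metric.ball 0 R, ENNReal.ofReal (‖measureFourier μ ξ‖ ^ 2)
        ≤ ENNReal.ofReal (K * R ^ (1 - s)) := by
  obtain ⟨K, hK, H⟩ := h.exists_gaussian_energy_le hC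
  refine ⟨Real.exp Real.pi * K, by positivity, fun R hR => ?_⟩
  calc _ ≤ ∫⁻ ξ in Metric.ball 0 R, ENNReal.ofReal (Real.exp Real.pi) *
          ENNReal.ofReal (‖measureFourier μ ξ‖ ^ 2 * Real.exp (-Real.pi * (ξ / R) ^ 2)) := by
        refine setLIntegral_mono' Metric.isOpen_ball.measurableSet fun ξ hξ => ?_
        rw [← ENNReal.ofReal_mul (by positivity)]
        apply ENNReal.ofReal_le_ofReal
        rw [mul_left_comm, ← Real.exp_add]
        refine le_mul_of_one_le_right (by positivity) (Real.one_le_exp ?_)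
        have : (ξ / R) ^ 2 ≤ 1 := by
          rw [sq_le_one_iff_abs_le_one, abs_div, abs_of_pos hR, div_le_one hR]
          rw [mem_ball_zero_iff, Real.norm_eq_abs] at hξ
          exact hξ.le
        nlinarith [Real.pi_pos]
    _ ≤ ENNReal.ofReal (Real.exp Real.pi) * ENNReal.ofReal (K * R ^ (1 - s)) := by
        rw [lintegral_const_mul' _ _ (by simp)]
        gcongr
        exact (setLIntegral_le_lintegral _ _).trans (H R hR)
    _ = _ := by rw [← ENNReal.ofReal_mul (by positivity), mul_assoc]

end MassBound

/-! ### Comparison of the correlation dimension with the regularity exponent. -/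

section KappaTwo

theorem kappaTwo_nonneg (μ : Measure ℝ) : 0 ≤ kappaTwo μ :=
  Real.sSup_nonneg fun _ h => h.1

theorem kappaTwo_le_one (μ : Measure ℝ) : kappaTwo μ ≤ 1 :=
  Real.sSup_le (fun _ h => h.2.1.le) zero_le_one

theorem ofReal_le_measure_of_le_measureReal {α : Type*} [MeasurableSpace α] {μ : Measure α}
    {s : Set α} {c : ℝ} [IsFiniteMeasure μ] (h : c ≤ μ.real s) : ENNReal.ofReal c ≤ μ s := by
  rw [← ofReal_measureReal]; exact ENNReal.ofReal_le_ofReal h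

/-- A lower mass bound with exponent `s` limits the energy decay: `κ₂ ≤ s`. -/
theorem kappaTwo_le_of_lower_bound {μ : Measure ℝ} [IsProbabilityMeasure μ] {s C : ℝ} (hs : 0 ≤ s)
    (hC : 0 < C) (h : ∀ x ∈ μ.support, ∀ r : ℝ, 0 < r → r ≤ 1 → C * r ^ s ≤ μ.real (Metric.ball x r)) :
    kappaTwo μ ≤ s := by
  refine Real.sSup_le ?_ hs
  rintro s' ⟨-, -, D, hD⟩
  by_contra! hlt
  obtain ⟨K, hK, H⟩ := exists_lintegral_gaussian_le (1 - s')
  have hm : Measurable fun ξ => ENNReal.ofReal (‖measureFourier μ ξ‖ ^ 2) :=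
    ((continuous_measureFourier μ).norm.pow 2).measurable.ennreal_ofReal
  have hball : ∀ r, 0 < r → (volume.withDensity fun ξ => ENNReal.ofReal (‖measureFourier μ ξ‖ ^ 2))
      (Metric.ball 0 r) ≤ ENNReal.ofReal (|D| * r ^ (1 - s')) := by
    intro r hr
    rw [withDensity_apply _ Metric.isOpen_ball.measurableSet, ← ofReal_integral_eq_lintegral_ofReal]
    · apply ENNReal.ofReal_le_ofReal
      have := hD r hr
      simp only [Real.rpow_two] at this
      refine this.trans ?_
      gcongr
      exact le_abs_self D
    · refine (ContinuousOn.integrableOn_compact (isCompact_closedBall 0 r) ?_).mono_set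
        Metric.ball_subset_closedBall
      exact ((continuous_measureFourier μ).norm.pow 2).continuousOn
    · exact ae_of_all _ fun _ => by positivity
  -- Both sides bound the same Gaussian energy at scale `R`: below by the mass of balls of radius
  -- `1/R`, above by the assumed decay. Letting `R → ∞` contradicts `s < s'`.
  have key : ∀ R : ℝ, 1 ≤ R → Real.exp (-Real.pi) * C * R ^ (1 - s) ≤ K * |D| * R ^ (1 - s') := by
    intro R hR
    have hR0 : 0 < R := by linarith
    have h1 := H _ |D| R (abs_nonneg _) hR0 hball
    rw [lintegral_withDensity_eq_lintegral_mul _ hm (by fun_prop)] at h1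
    simp only [Pi.mul_apply] at h1
    simp_rw [← ENNReal.ofReal_mul (sq_nonneg ‖measureFourier μ _‖)] at h1
    rw [lintegral_norm_sq_measureFourier_mul_gaussian μ hR0] at h1
    have h2 : ENNReal.ofReal (Real.exp (-Real.pi) * C * R ^ (1 - s)) ≤ ENNReal.ofReal R *
        ∫⁻ x, ∫⁻ y, ENNReal.ofReal (Real.exp (-Real.pi * (R * (y - x)) ^ 2)) ∂μ ∂μ := by
      have h3 : Real.exp (-Real.pi) * C * R ^ (1 - s)
          = R * (Real.exp (-Real.pi) * (C * R⁻¹ ^ s)) := by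
        rw [Real.inv_rpow hR0.le, Real.rpow_sub hR0, Real.rpow_one]; ring
      rw [h3, ENNReal.ofReal_mul hR0.le]
      gcongr
      calc _ = ∫⁻ _, ENNReal.ofReal (Real.exp (-Real.pi) * (C * R⁻¹ ^ s)) ∂μ := by simp
        _ ≤ _ := by
          apply lintegral_mono_ae
          filter_upwards [Measure.support_mem_ae (μ := μ)] with x hx
          rw [ENNReal.ofReal_mul (by positivity)]
          calc _ ≤ ENNReal.ofReal (Real.exp (-Real.pi)) * μ (Metric.ball x R⁻¹) := by
                gcongr
                exact ofReal_le_measure_of_le_measureReal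
                  (h x hx _ (by positivity) (inv_le_one_of_one_le₀ hR))
            _ = ∫⁻ _ in Metric.ball x R⁻¹, ENNReal.ofReal (Real.exp (-Real.pi)) ∂μ := by
                rw [setLIntegral_const]
            _ ≤ ∫⁻ y in Metric.ball x R⁻¹,
                  ENNReal.ofReal (Real.exp (-Real.pi * (R * (y - x)) ^ 2)) ∂μ := by
                refine setLIntegral_mono (by fun_prop) fun y hy => ?_
                apply ENNReal.ofReal_le_ofReal
                apply Real.exp_le_exp.2
                rw [Metric.mem_ball, Real.dist_eq, ← one_div, lt_div_iff₀ hR0] at hy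
                have : (R * (y - x)) ^ 2 ≤ 1 := by
                  rw [sq_le_one_iff_abs_le_one, abs_mul, abs_of_pos hR0]; linarith
                nlinarith [Real.pi_pos]
            _ ≤ _ := setLIntegral_le_lintegral _ _
    exact (ENNReal.ofReal_le_ofReal_iff (by positivity)).1 (h2.trans h1)
  have hlim := tendsto_rpow_atTop (y := s' - s) (by linarith)
  obtain ⟨R, hR, hR1⟩ := ((hlim.eventually_gt_atTop (K * |D| / (Real.exp (-Real.pi) * C))).and
    (eventually_ge_atTop 1)).exists
  have hR0 : 0 < R := by linarith
  have h1 := key R hR1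
  rw [div_lt_iff₀ (by positivity)] at hR
  have h2 : R ^ (1 - s) = R ^ (s' - s) * R ^ (1 - s') := by
    rw [← Real.rpow_add hR0]; congr 1; ring
  rw [h2] at h1
  have h3 : 0 < R ^ (1 - s') := by positivity
  nlinarith

/-- The regularity exponent is at least `κ₂`, hence `r^s ≤ r^κ₂` for `r ≤ 1`. The factor `2^κ₂` pays
for recentring a ball at a point of the support and for large radii. -/
theorem IsADRegular.exists_massBound {μ : Measure ℝ} [IsProbabilityMeasure μ] (h : IsADRegular μ) :
    ∃ C : ℝ, 0 ≤ C ∧ MassBound μ (kappaTwo μ) C := by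
  obtain ⟨s, C, hs, hC, H⟩ := h
  have hκ : kappaTwo μ ≤ s := kappaTwo_le_of_lower_bound hs (C := C⁻¹) (by positivity)
    fun x hx r hr hr1 => (H x hx r hr hr1).1
  have hκ0 := kappaTwo_nonneg μ
  refine ⟨C * 2 ^ kappaTwo μ, by positivity, fun x r hr => ?_⟩
  rw [mul_assoc, ← Real.mul_rpow zero_le_two hr.le]
  rcases le_or_gt (2 * r) 1 with hr1 | hr1
  · by_cases hne : ((Metric.ball x r) ∩ μ.support).Nonempty
    · obtain ⟨y, hy, hyS⟩ := hne
      have h1 : Metric.ball x r ⊆ Metric.ball y (2 * r) := by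
        intro z hz
        rw [Metric.mem_ball] at *
        linarith [dist_triangle z x y, dist_comm x y]
      refine (measure_mono h1).trans ?_
      rw [← ofReal_measureReal]
      refine ENNReal.ofReal_le_ofReal ((H y hyS _ (by positivity) hr1).2.trans ?_)
      exact mul_le_mul_of_nonneg_left
        (Real.rpow_le_rpow_of_exponent_ge (by positivity) hr1 hκ) (by linarith)
    · have : μ (Metric.ball x r) = 0 := by
        refine measure_mono_null (t := μ.supportᶜ) ?_ Measure.measure_compl_support
        exact fun y hy hyS => hne ⟨y, hy, hyS⟩
      simp [this]
  · refine prob_le_one.trans ?_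
    rw [← ENNReal.ofReal_one]
    apply ENNReal.ofReal_le_ofReal
    have := Real.one_le_rpow hr1.le hκ0
    nlinarith

end KappaTwo

/-! ### Stopping-time decomposition of a self-similar measure. -/

section Decomposition

/-- Iterating the self-similarity relation until the pieces have contraction ratio at most `r`,
or for at most `L` generations. -/
theorem exists_selfSimilar_decomposition {N : ℕ} {a t p : Fin N → ℝ} {μ : Measure ℝ}
    (ha : ∀ i, a i ≠ 0) (hp : ∀ i, 0 < p i) (hsum : ∑ i, p i = 1)
    (hμ : μ = ∑ i, ENNReal.ofReal (p i) • μ.map (fun x : ℝ => a i * x + t i))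
    {c ρ : ℝ} (hc : 0 ≤ c) (hc1 : c ≤ 1) (hca : ∀ i, c ≤ |a i|) (haρ : ∀ i, |a i| ≤ ρ)
    {r : ℝ} (hr : 0 ≤ r) (hr1 : r ≤ 1) (L : ℕ) :
    ∃ (ι : Type) (_ : Fintype ι) (b u q : ι → ℝ), (∀ j, 0 < q j) ∧ ∑ j, q j = 1 ∧
      μ = ∑ j, ENNReal.ofReal (q j) • μ.map (fun x : ℝ => b j * x + u j) ∧
      ∀ j, b j ≠ 0 ∧ c * r ≤ |b j| ∧ (∃ n : Fin N → ℕ, (∀ i, n i ≤ L) ∧ b j = ∏ i, a i ^ n i) ∧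
        (|b j| ≤ r ∨ |b j| ≤ ρ ^ L) := by
  classical
  induction L with
  | zero =>
    refine ⟨Unit, inferInstance, fun _ => 1, fun _ => 0, fun _ => 1, by simp, by simp, by simp, ?_⟩
    intro _
    refine ⟨one_ne_zero, ?_, ⟨fun _ => 0, by simp, by simp⟩, by simp⟩
    rw [abs_one]
    exact mul_le_one₀ hc1 hr hr1
  | succ L ih =>
    obtain ⟨ι, _, b, u, q, hq, hq1, hμq, hb⟩ := ih
    refine ⟨ι × Fin N, inferInstance, fun z => if |b z.1| ≤ r then b z.1 else b z.1 * a z.2,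
      fun z => if |b z.1| ≤ r then u z.1 else b z.1 * t z.2 + u z.1, fun z => q z.1 * p z.2,
      fun z => mul_pos (hq _) (hp _), ?_, ?_, ?_⟩
    · rw [Fintype.sum_prod_type]
      simp_rw [← Finset.mul_sum, hsum, mul_one, hq1]
    · rw [Fintype.sum_prod_type]
      refine hμq.trans (Finset.sum_congr rfl fun j _ => ?_)
      have key : μ.map (fun x : ℝ => b j * x + u j) = ∑ i, ENNReal.ofReal (p i) •
          μ.map (fun x => (if |b j| ≤ r then b j else b j * a i) * x
            + (if |b j| ≤ r then u j else b j * t i + u j)) := by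
        by_cases hbr : |b j| ≤ r
        · simp only [hbr, if_true]
          rw [← Finset.sum_smul, ← ENNReal.ofReal_sum_of_nonneg fun i _ => (hp i).le, hsum]
          simp
        · simp only [hbr, if_false]
          conv_lhs => rw [hμ]
          rw [Measure.map_finset_sum (by fun_prop)]
          refine Finset.sum_congr rfl fun i _ => ?_
          rw [Measure.map_smul, Measure.map_map (by fun_prop) (by fun_prop)]
          congr 2
          ext x
          simp only [Function.comp]; ring
      rw [key, Finset.smul_sum]
      refine Finset.sum_congr rfl fun i _ => ?_
      rw [smul_smul, ENNReal.ofReal_mul (hq j).le]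
    · rintro ⟨j, i⟩
      obtain ⟨hb0, hcb, ⟨n, hn, hbn⟩, hbr⟩ := hb j
      by_cases hj : |b j| ≤ r
      · simp only [hj, if_true]
        exact ⟨hb0, hcb, ⟨n, fun i => (hn i).trans L.le_succ, hbn⟩, Or.inl trivial⟩
      · simp only [hj, if_false]
        refine ⟨mul_ne_zero hb0 (ha i), ?_, ⟨n + Pi.single i 1, fun k => ?_, ?_⟩, Or.inr ?_⟩
        -- A piece is split only while its ratio exceeds `r`, so one more map leaves it at least `c
        -- * r`.
        · rw [abs_mul, mul_comm]
          exact mul_le_mul (not_le.1 hj).le (hca i) hc (abs_nonneg _)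
        · have := hn k
          simp only [Pi.add_apply, Pi.single_apply]
          split_ifs <;> omega
        · simp only [Pi.add_apply, pow_add, Finset.prod_mul_distrib, ← hbn]
          congr 1
          rw [Finset.prod_eq_single i]
          · simp
          · intro k _ hk; simp [hk]
          · simp
        · rw [abs_mul, pow_succ]
          have h0 : 0 ≤ ρ := (abs_nonneg _).trans (haρ i)
          exact mul_le_mul (hbr.resolve_left hj) (haρ i) (abs_nonneg _) (pow_nonneg h0 _)

end Decomposition

/-! ### A large-sieve inequality for discrete frequencies. -/

section Sampling

theorem sq_integral_le_integral_sq {α : Type*} [MeasurableSpace α] {m : Measure α}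
    [IsFiniteMeasure m] (hm : m.real Set.univ ≤ 1) {f : α → ℝ} (hf : Integrable f m)
    (hf2 : Integrable (fun x => f x ^ 2) m) : (∫ x, f x ∂m) ^ 2 ≤ ∫ x, f x ^ 2 ∂m := by
  set A := ∫ x, f x ∂m with hA
  have h0 : 0 ≤ ∫ x, (f x - A) ^ 2 ∂m := integral_nonneg fun x => sq_nonneg _
  have h1 : ∫ x, (f x - A) ^ 2 ∂m = ∫ x, f x ^ 2 ∂m - 2 * A * A + A ^ 2 * m.real Set.univ := by
    have : (fun x => (f x - A) ^ 2) = fun x => (f x ^ 2 - 2 * A * f x) + A ^ 2 := by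
      ext x; ring
    have h2 : Integrable (fun x => f x ^ 2 - 2 * A * f x) m := hf2.sub (hf.const_mul _)
    rw [this, integral_add h2 (integrable_const _), integral_sub hf2 (hf.const_mul _), integral_const_mul, integral_const, smul_eq_mul, ← hA]
    ring
  nlinarith [mul_le_mul_of_nonneg_left hm (sq_nonneg A)]

theorem fourier_indicator_Ioc (η δ : ℝ) (hδ : 0 ≤ δ) {x : ℝ} (hx : x ≠ 0) :
    𝓕 ((Set.Ioc (η - δ) (η + δ)).indicator fun _ => (1 : ℂ)) x =
      Complex.exp (-2 * Real.pi * Complex.I * η * x) *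
        ((Real.sin (2 * Real.pi * δ * x) / (Real.pi * x) : ℝ) : ℂ) := by
  rw [Real.fourier_eq']
  have h1 : ∀ v : ℝ, Complex.exp (↑(-2 * Real.pi * inner ℝ v x) * Complex.I) •
      (Set.Ioc (η - δ) (η + δ)).indicator (fun _ => (1 : ℂ)) v
      = (Set.Ioc (η - δ) (η + δ)).indicator
        (fun v : ℝ => Complex.exp ((-2 * Real.pi * Complex.I * x) * v)) v := by
    intro v
    by_cases hv : v ∈ Set.Ioc (η - δ) (η + δ)
    · simp only [Set.indicator_of_mem hv, smul_eq_mul, mul_one]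
      congr 1
      simp
      ring
    · simp [Set.indicator_of_notMem hv]
  simp_rw [h1]
  rw [integral_indicator measurableSet_Ioc, ← intervalIntegral.integral_of_le (by linarith)]
  have hπ : (Real.pi : ℂ) ≠ 0 := by exact_mod_cast Real.pi_ne_zero
  have hx' : (x : ℂ) ≠ 0 := by exact_mod_cast hx
  have hc : (-2 * Real.pi * Complex.I * x : ℂ) ≠ 0 := by
    simp [hπ, hx']
  rw [integral_exp_mul_complex hc]
  push_cast
  have e1 : Complex.exp (-2 * Real.pi * Complex.I * x * (η + δ)) =
      Complex.exp (-2 * Real.pi * Complex.I * η * x) *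
        Complex.exp (-(2 * Real.pi * δ * x) * Complex.I) := by
    rw [← Complex.exp_add]; congr 1; ring
  have e2 : Complex.exp (-2 * Real.pi * Complex.I * x * (η - δ)) =
      Complex.exp (-2 * Real.pi * Complex.I * η * x) *
        Complex.exp ((2 * Real.pi * δ * x) * Complex.I) := by
    rw [← Complex.exp_add]; congr 1; ring
  rw [e1, e2, Complex.sin, div_eq_iff hc]
  generalize Complex.exp (-(2 * Real.pi * δ * x) * Complex.I) = P
  generalize Complex.exp ((2 * Real.pi * δ * x) * Complex.I) = Q
  generalize Complex.exp (-2 * Real.pi * Complex.I * η * x) = E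
  have : E * ((P - Q) * Complex.I / 2 / (Real.pi * x)) * (-2 * Real.pi * Complex.I * x)
      = E * (P - Q) * (-(Complex.I * Complex.I)) := by
    field_simp
  rw [this, Complex.I_mul_I]
  ring

/-- The Fourier transform of a measure on a bounded interval of positive reals is controlled
pointwise by local `L²` averages of the Fourier transform of a comparable measure. -/
theorem exists_measureFourier_sq_le_local_average {μ : Measure ℝ} [IsFiniteMeasure μ] {M : ℝ}
    (hM : 0 < M) (hμ : ∀ᵐ x ∂μ, x ∈ Set.Ioc 0 M) :
    ∃ (δ A : ℝ) (ν : Measure ℝ), 0 < δ ∧ δ ≤ 1 / 2 ∧ 0 ≤ A ∧ IsFiniteMeasure ν ∧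
      ν ≤ ENNReal.ofReal A • μ ∧
      ∀ η, ‖measureFourier μ η‖ ^ 2 ≤
        ∫ v in Set.Ioc (η - δ) (η + δ), ‖measureFourier ν v‖ ^ 2 := by
  -- The bound `1/(4M)` keeps `2πδx ≤ π/2` on `(0, M]`, where `sin` is bounded below by a linear
  -- function; the bound `1/2` makes the window have length at most `1`, as
  -- `sq_integral_le_integral_sq` requires.
  set δ := min (1 / 2) (1 / (4 * M)) with hδ
  have hδ0 : 0 < δ := by positivity
  have hδM : δ * M ≤ 1 / 4 := by
    have : δ ≤ 1 / (4 * M) := min_le_right _ _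
    calc δ * M ≤ 1 / (4 * M) * M := by gcongr
      _ = 1 / 4 := by field_simp
  set D : ℝ → ℝ := fun x => Real.sin (2 * Real.pi * δ * x) / (Real.pi * x) with hD
  have hDlb : ∀ x ∈ Set.Ioc 0 M, 4 * δ / Real.pi ≤ D x := by
    intro x hx
    have hπ := Real.pi_pos
    have hx0 := hx.1
    have h1 : 2 * Real.pi * δ * x ≤ Real.pi / 2 := by
      have : δ * x ≤ 1 / 4 := (mul_le_mul_of_nonneg_left hx.2 hδ0.le).trans hδM
      nlinarith
    have h2 := Real.mul_le_sin (x := 2 * Real.pi * δ * x) (by positivity) h1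
    rw [hD, div_le_div_iff₀ hπ (by positivity)]
    have h3 : 2 / Real.pi * (2 * Real.pi * δ * x) = 4 * δ * x := by field_simp; ring
    rw [h3] at h2
    nlinarith
  have hDpos : ∀ x ∈ Set.Ioc 0 M, 0 < D x := fun x hx =>
    lt_of_lt_of_le (by have := Real.pi_pos; positivity) (hDlb x hx)
  set A := Real.pi / (4 * δ) with hA
  have hDm : Measurable D := by
    simp only [hD]
    fun_prop
  set φ : ℝ → ℝ≥0∞ := fun x => ENNReal.ofReal (D x)⁻¹ with hφ
  have hφm : Measurable φ := hDm.inv.ennreal_ofReal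
  have hle : μ.withDensity φ ≤ ENNReal.ofReal A • μ := by
    rw [← withDensity_const]
    refine withDensity_mono ?_
    filter_upwards [hμ] with x hx
    apply ENNReal.ofReal_le_ofReal
    rw [hA, ← inv_div]
    exact inv_anti₀ (by have := Real.pi_pos; positivity) (hDlb x hx)
  have hfin : IsFiniteMeasure (μ.withDensity φ) := by
    have : IsFiniteMeasure (ENNReal.ofReal A • μ) := Measure.smul_finite μ ENNReal.ofReal_ne_top
    exact isFiniteMeasure_of_le _ hle
  refine ⟨δ, A, μ.withDensity φ, hδ0, min_le_left _ _, by have := Real.pi_pos; positivity, hfin,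
    hle, fun η => ?_⟩
  set ν := μ.withDensity φ
  have hint : IntegrableOn (measureFourier ν) (Set.Ioc (η - δ) (η + δ)) :=
    (continuous_measureFourier ν).integrableOn_Ioc
  -- Averaging over the window multiplies the measure by the kernel `D`; the density `1/D` of `ν`
  -- was chosen to cancel it exactly.
  have hid : measureFourier μ η = ∫ v in Set.Ioc (η - δ) (η + δ), measureFourier ν v := by
    have h1 := integral_measureFourier_mul ν
      (g := (Set.Ioc (η - δ) (η + δ)).indicator fun _ => (1 : ℂ))
      ((integrable_indicator_iff measurableSet_Ioc).2 (by simp [IntegrableOn]))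
    have h2 : ∫ v in Set.Ioc (η - δ) (η + δ), measureFourier ν v
        = ∫ v, measureFourier ν v * (Set.Ioc (η - δ) (η + δ)).indicator (fun _ => (1 : ℂ)) v := by
      rw [← integral_indicator measurableSet_Ioc]
      congr 1; ext v
      by_cases hv : v ∈ Set.Ioc (η - δ) (η + δ) <;> simp [hv]
    rw [h2, h1, integral_withDensity_eq_integral_toReal_smul hφm (by simp [hφ])]
    unfold measureFourier
    refine integral_congr_ae ?_
    filter_upwards [hμ] with x hx
    rw [fourier_indicator_Ioc η δ hδ0.le hx.1.ne']
    have h3 := hDpos x hx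
    rw [hφ, ENNReal.toReal_ofReal (by positivity), Complex.real_smul, mul_left_comm,
      ← Complex.ofReal_mul]
    have h4 : (D x)⁻¹ * (Real.sin (2 * Real.pi * δ * x) / (Real.pi * x)) = 1 :=
      inv_mul_cancel₀ h3.ne'
    rw [h4]; simp
  rw [hid]
  refine le_trans (pow_le_pow_left₀ (norm_nonneg _) (norm_integral_le_integral_norm _) 2) ?_
  refine sq_integral_le_integral_sq ?_ hint.norm ?_
  · rw [measureReal_restrict_apply_univ, Real.volume_real_Ioc_of_le (by linarith)]
    have : δ ≤ 1 / 2 := min_le_left _ _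
    linarith
  · exact ((continuous_measureFourier ν).norm.pow 2).integrableOn_Ioc

theorem MassBound.of_le_smul {μ ν : Measure ℝ} {s C A : ℝ} (hA : 0 ≤ A)
    (h : MassBound μ s C) (hν : ν ≤ ENNReal.ofReal A • μ) : MassBound ν s (A * C) := by
  intro x r hr
  refine (hν _).trans ?_
  rw [Measure.smul_apply, smul_eq_mul, mul_assoc, ENNReal.ofReal_mul hA]
  exact mul_le_mul_right (h x r hr) _

/-- A large-sieve type inequality for the Fourier transform of a measure satisfying a mass
bound. -/
theorem MassBound.exists_sum_sq_measureFourier_le {μ : Measure ℝ} [IsFiniteMeasure μ] {M s C : ℝ}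
    (hC : 0 ≤ C) (h : MassBound μ s C) (hM : 0 < M) (hμ : ∀ᵐ x ∂μ, x ∈ Set.Ioc 0 M) :
    ∃ δ K : ℝ, 0 < δ ∧ δ ≤ 1 / 2 ∧ 0 ≤ K ∧
      ∀ (ι : Type) [Fintype ι] (η q : ι → ℝ) (T Θ : ℝ), (∀ j, 0 ≤ q j) → (∀ j, |η j| ≤ T) → 0 < T →
        0 ≤ Θ → (∀ v, ∑ j with |η j - v| ≤ δ, q j ≤ Θ) →
        ∑ j, q j * ‖measureFourier μ (η j)‖ ^ 2 ≤ K * Θ * (T + 1) ^ (1 - s) := by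
  obtain ⟨δ, A, ν, hδ, hδ1, hA, hfin, hle, H⟩ := exists_measureFourier_sq_le_local_average hM hμ
  obtain ⟨K, hK, HK⟩ := (h.of_le_smul hA hle).exists_energy_le (by positivity)
  refine ⟨δ, K, hδ, hδ1, hK, fun ι _ η q T Θ hq hη hT hΘ hsum => ?_⟩
  have hcont := (continuous_measureFourier ν).norm.pow 2
  set F : ℝ → ℝ := fun v => ‖measureFourier ν v‖ ^ 2 with hF
  have hball : ∫ v in Metric.ball 0 (T + 1), F v ≤ K * (T + 1) ^ (1 - s) := by
    have h1 := HK (T + 1) (by linarith)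
    rw [← ofReal_integral_eq_lintegral_ofReal] at h1
    · exact (ENNReal.ofReal_le_ofReal_iff (by positivity)).1 h1
    · exact (hcont.continuousOn.integrableOn_compact (isCompact_closedBall 0 (T + 1))).mono_set
        Metric.ball_subset_closedBall
    · exact ae_of_all _ fun _ => by positivity
  have hintball : IntegrableOn F (Metric.ball 0 (T + 1)) :=
    (hcont.continuousOn.integrableOn_compact (isCompact_closedBall 0 (T + 1))).mono_set
        Metric.ball_subset_closedBall
  have hsub : ∀ j, Set.Ioc (η j - δ) (η j + δ) ⊆ Metric.ball 0 (T + 1) := by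
    intro j v hv
    rw [mem_ball_zero_iff, Real.norm_eq_abs, abs_lt]
    have := abs_le.1 (hη j)
    constructor <;> linarith [hv.1, hv.2]
  have hmeas := (Metric.isOpen_ball (x := (0 : ℝ)) (ε := T + 1)).measurableSet
  have hterm : ∀ j, ∫ v in Set.Ioc (η j - δ) (η j + δ), F v
      = ∫ v in Metric.ball 0 (T + 1), (Set.Ioc (η j - δ) (η j + δ)).indicator F v := by
    intro j
    rw [setIntegral_indicator measurableSet_Ioc, Set.inter_eq_right.2 (hsub j)]
  have hintj : ∀ j, IntegrableOn ((Set.Ioc (η j - δ) (η j + δ)).indicator F)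
      (Metric.ball 0 (T + 1)) := fun j => hintball.indicator measurableSet_Ioc
  calc ∑ j, q j * ‖measureFourier μ (η j)‖ ^ 2
      ≤ ∑ j, q j * ∫ v in Set.Ioc (η j - δ) (η j + δ), F v :=
        Finset.sum_le_sum fun j _ => mul_le_mul_of_nonneg_left (H _) (hq j)
    _ = ∫ v in Metric.ball 0 (T + 1),
          ∑ j, q j * (Set.Ioc (η j - δ) (η j + δ)).indicator F v := by
        rw [integral_finsetSum _ fun j _ => (hintj j).const_mul _]
        refine Finset.sum_congr rfl fun j _ => ?_
        rw [hterm, integral_const_mul]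
    _ ≤ ∫ v in Metric.ball 0 (T + 1), Θ * F v := by
        refine setIntegral_mono_on (integrable_finsetSum _ fun j _ => (hintj j).const_mul _)
          (hintball.const_mul _) hmeas fun v _ => ?_
        refine le_trans ?_ (mul_le_mul_of_nonneg_right (hsum v) (by positivity : 0 ≤ F v))
        -- At a given `v` only frequencies within `δ` contribute, and their total weight is at most
        -- `Θ`.
        rw [Finset.sum_mul, Finset.sum_filter]
        refine Finset.sum_le_sum fun j _ => ?_
        by_cases hv : v ∈ Set.Ioc (η j - δ) (η j + δ)
        · have : |η j - v| ≤ δ := by rw [abs_le]; constructor <;> linarith [hv.1, hv.2]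
          simp [hv, this]
        · have h0 : 0 ≤ q j * F v := mul_nonneg (hq j) (by positivity)
          simp only [Set.indicator_of_notMem hv, mul_zero]
          split_ifs <;> first | exact h0 | exact le_rfl
    _ = Θ * ∫ v in Metric.ball 0 (T + 1), F v := integral_const_mul _ _
    _ ≤ Θ * (K * (T + 1) ^ (1 - s)) := mul_le_mul_of_nonneg_left hball hΘ
    _ = _ := by ring

end Sampling

/-! ### Pointwise Fourier decay of the logarithm of a self-similar measure. -/

section Decay

theorem IsSelfSimilarMeasure.exists_ae_mem_Icc {μ : Measure ℝ} (h : IsSelfSimilarMeasure μ)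
    (hpos : μ.support ⊆ Set.Ioi 0) : ∃ m M : ℝ, 0 < m ∧ m ≤ M ∧ ∀ᵐ x ∂μ, x ∈ Set.Icc m M := by
  obtain ⟨hprob, N, a, t, p, K, -, -, -, -, -, hK, -, -, hμK, -⟩ := h
  have hsub : μ.support ⊆ K := Measure.support_subset_of_isClosed hK.isClosed hμK
  have hcomp : IsCompact μ.support := hK.of_isClosed_subset Measure.isClosed_support hsub
  have hne : μ.support.Nonempty := Measure.nonempty_support (IsProbabilityMeasure.ne_zero μ)
  refine ⟨sInf μ.support, sSup μ.support, hpos (hcomp.sInf_mem hne), ?_, ?_⟩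
  · exact Real.sInf_le_sSup _ hcomp.bddBelow hcomp.bddAbove
  · filter_upwards [Measure.support_mem_ae (μ := μ)] with x hx
    exact ⟨csInf_le hcomp.bddBelow hx, le_csSup hcomp.bddAbove hx⟩

theorem abs_log_sub_linear_le {m x y : ℝ} (hm : 0 < m) (hx : m ≤ x) (hy : m ≤ y) :
    |Real.log x - (Real.log y + (x - y) / y)| ≤ (x - y) ^ 2 / m ^ 2 := by
  have hx0 : 0 < x := by linarith
  have hy0 : 0 < y := by linarith
  have h1 := Real.log_le_sub_one_of_pos (div_pos hx0 hy0)
  have h2 := Real.one_sub_inv_le_log_of_pos (div_pos hx0 hy0)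
  rw [Real.log_div hx0.ne' hy0.ne'] at h1 h2
  have h3 : x / y - 1 = (x - y) / y := by field_simp
  have h4 : 1 - (x / y)⁻¹ = (x - y) / y - (x - y) ^ 2 / (x * y) := by field_simp; ring
  have h5 : (x - y) ^ 2 / (x * y) ≤ (x - y) ^ 2 / m ^ 2 := by
    have : m ^ 2 ≤ x * y := by nlinarith
    gcongr
  have h6 : 0 ≤ (x - y) ^ 2 / m ^ 2 := by positivity
  rw [h3] at h1
  rw [h4] at h2
  rw [abs_le]
  constructor <;> linarith

theorem norm_exp_I_sub_exp_I_le (a b : ℝ) :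
    ‖Complex.exp (Complex.I * a) - Complex.exp (Complex.I * b)‖ ≤ |a - b| := by
  have h : Complex.exp (Complex.I * a) - Complex.exp (Complex.I * b)
      = Complex.exp (Complex.I * b) * (Complex.exp (Complex.I * ((a - b : ℝ) : ℂ)) - 1) := by
    rw [mul_sub, ← Complex.exp_add, mul_one]
    congr 2
    push_cast; ring
  rw [h, norm_mul, Complex.norm_exp_I_mul_ofReal, one_mul]
  exact Real.norm_exp_I_mul_ofReal_sub_one_le

/-- Linearise the phase at `y = b * x₀ + u`. The constant part has modulus one, the linear part is
`μ̂` at `ξ * b / y`, and the quadratic remainder is of order `|ξ| r²`. -/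
theorem norm_integral_exp_log_affine_le {μ : Measure ℝ} [IsProbabilityMeasure μ] {m M b u x₀ r : ℝ}
    (hm : 0 < m) (hμ : ∀ᵐ x ∂μ, x ∈ Set.Icc m M)
    (hbu : ∀ᵐ x ∂μ, b * x + u ∈ Set.Icc m M) (hx₀ : x₀ ∈ Set.Icc m M)
    (hy₀ : b * x₀ + u ∈ Set.Icc m M) (hb : |b| ≤ r) (ξ : ℝ) :
    ‖∫ x, Complex.exp (-2 * Real.pi * Complex.I * ξ * (Real.log (b * x + u) : ℝ)) ∂μ‖
      ≤ ‖measureFourier μ (ξ * b / (b * x₀ + u))‖ + 2 * Real.pi * M ^ 2 / m ^ 2 * (|ξ| * r ^ 2) := by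
  set y := b * x₀ + u with hy
  set f : ℝ → ℂ := fun x => Complex.exp (Complex.I * ((-2 * Real.pi * ξ * Real.log (b * x + u) : ℝ) : ℂ))
  set g : ℝ → ℂ := fun x => Complex.exp
    (Complex.I * ((-2 * Real.pi * ξ * (Real.log y + b * (x - x₀) / y) : ℝ) : ℂ))
  have hf : ∀ x, Complex.exp (-2 * Real.pi * Complex.I * ξ * (Real.log (b * x + u) : ℝ)) = f x := by
    intro x; simp only [f]; congr 1; push_cast; ring
  have hfi : Integrable f μ := by
    refine Integrable.mono' (integrable_const (1 : ℝ)) ?_ (ae_of_all _ fun x => ?_)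
    · exact Measurable.aestronglyMeasurable (by fun_prop)
    · rw [Complex.norm_exp_I_mul_ofReal]
  have hgi : Integrable g μ := by
    refine Integrable.mono' (integrable_const (1 : ℝ)) ?_ (ae_of_all _ fun x => ?_)
    · exact Measurable.aestronglyMeasurable (by fun_prop)
    · rw [Complex.norm_exp_I_mul_ofReal]
  have hg : ‖∫ x, g x ∂μ‖ = ‖measureFourier μ (ξ * b / y)‖ := by
    have : ∀ x, g x = Complex.exp (Complex.I *
        ((-2 * Real.pi * ξ * (Real.log y - b * x₀ / y) : ℝ) : ℂ)) *
        Complex.exp (-2 * Real.pi * Complex.I * ((ξ * b / y : ℝ) : ℂ) * x) := by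
      intro x
      simp only [g]
      rw [← Complex.exp_add]
      congr 1
      push_cast
      ring
    simp_rw [this]
    rw [integral_const_mul, norm_mul, Complex.norm_exp_I_mul_ofReal, one_mul, measureFourier]
  simp_rw [hf]
  have hdiff : ‖∫ x, f x ∂μ - ∫ x, g x ∂μ‖ ≤ 2 * Real.pi * M ^ 2 / m ^ 2 * (|ξ| * r ^ 2) := by
    rw [← integral_sub hfi hgi]
    refine (norm_integral_le_of_norm_le_const (μ := μ)
      (C := 2 * Real.pi * M ^ 2 / m ^ 2 * (|ξ| * r ^ 2)) ?_).trans_eq (by simp)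
    filter_upwards [hμ, hbu] with x hx hxu
    refine (norm_exp_I_sub_exp_I_le _ _).trans ?_
    rw [← mul_sub, abs_mul]
    have h1 := abs_log_sub_linear_le hm hxu.1 hy₀.1
    have h2 : b * x + u - y = b * (x - x₀) := by rw [hy]; ring
    rw [h2] at h1
    have h3 : (b * (x - x₀)) ^ 2 ≤ r ^ 2 * M ^ 2 := by
      rw [mul_pow, ← sq_abs b, ← sq_abs (x - x₀)]
      have h4 : |x - x₀| ≤ M := by
        rw [abs_le]; constructor <;> linarith [hx.1, hx.2, hx₀.1, hx₀.2]
      gcongr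
    calc |-2 * Real.pi * ξ| * |Real.log (b * x + u) - (Real.log y + b * (x - x₀) / y)|
        ≤ |-2 * Real.pi * ξ| * (r ^ 2 * M ^ 2 / m ^ 2) := by
          gcongr
          exact h1.trans (by gcongr)
      _ = _ := by
          rw [abs_mul, abs_mul, abs_neg, abs_two, abs_of_pos Real.pi_pos]; ring
  calc ‖∫ x, f x ∂μ‖ = ‖∫ x, g x ∂μ + (∫ x, f x ∂μ - ∫ x, g x ∂μ)‖ := by congr 1; ring
    _ ≤ _ := (norm_add_le _ _).trans (by rw [hg]; gcongr)

theorem sum_weights_le_measure {μ : Measure ℝ} [IsProbabilityMeasure μ] {ι : Type} [Fintype ι]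
    {b u q : ι → ℝ} (hq : ∀ j, 0 < q j)
    (hμ : μ = ∑ j, ENNReal.ofReal (q j) • μ.map (fun x : ℝ => b j * x + u j)) (J : Finset ι)
    {E : Set ℝ} (hE : MeasurableSet E) (hJ : ∀ j ∈ J, ∀ᵐ x ∂μ, b j * x + u j ∈ E) :
    ENNReal.ofReal (∑ j ∈ J, q j) ≤ μ E := by
  conv_rhs => rw [hμ]
  rw [Measure.finsetSum_apply, ENNReal.ofReal_sum_of_nonneg fun j _ => (hq j).le]
  refine le_trans (Finset.sum_le_sum fun j hj => ?_)
    (Finset.sum_le_sum_of_subset (Finset.subset_univ J))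
  rw [Measure.smul_apply, smul_eq_mul, Measure.map_apply (by fun_prop) hE]
  have : μ ((fun x => b j * x + u j) ⁻¹' E) = 1 := by
    rw [← prob_compl_eq_zero_iff ((by fun_prop : Measurable fun x => b j * x + u j) hE)]
    exact hJ j hj
  rw [this, mul_one]

theorem ae_affine_mem_of_decomposition {μ : Measure ℝ} {ι : Type} [Fintype ι]
    {b u q : ι → ℝ} (hq : ∀ j, 0 < q j)
    (hμ : μ = ∑ j, ENNReal.ofReal (q j) • μ.map (fun x : ℝ => b j * x + u j))
    {E : Set ℝ} (hE : MeasurableSet E) (h : ∀ᵐ x ∂μ, x ∈ E) (j : ι) :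
    ∀ᵐ x ∂μ, b j * x + u j ∈ E := by
  have h0 : μ Eᶜ = 0 := h
  rw [hμ, Measure.finsetSum_apply, Finset.sum_eq_zero_iff] at h0
  have h1 := h0 j (Finset.mem_univ j)
  rw [Measure.smul_apply, smul_eq_mul, Measure.map_apply (by fun_prop) hE.compl] at h1
  exact (mul_eq_zero.1 h1).resolve_left (by simpa using hq j)

/-- Contraction ratios commute, so the count is polynomial in the depth although there are
exponentially many words. -/
theorem card_image_prod_pow_le {N : ℕ} (a : Fin N → ℝ) (L : ℕ) :
    (Finset.univ.image fun n : Fin N → Fin (L + 1) => ∏ i, a i ^ (n i : ℕ)).card ≤ (L + 1) ^ N :=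
  Finset.card_image_le.trans (by simp)

theorem exists_norm_measureFourier_map_log_le {μ : Measure ℝ} (hμ : IsSelfSimilarMeasure μ)
    {s C m M : ℝ} (hs1 : s ≤ 1) (hC : 0 ≤ C) (hmass : MassBound μ s C)
    (hm : 0 < m) (hmM : m ≤ M) (hsupp : ∀ᵐ x ∂μ, x ∈ Set.Icc m M) :
    ∃ (K ρ : ℝ) (N : ℕ), 0 ≤ K ∧ 0 < ρ ∧ ρ < 1 ∧ ∀ (ξ r : ℝ) (L : ℕ), 0 < r → r ≤ 1 →
      1 ≤ |ξ| * r → |ξ| * r ^ 2 ≤ 1 → ρ ^ L ≤ r →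
      ‖measureFourier (μ.map Real.log) ξ‖ ≤ K * (|ξ| * r ^ 2) +
        √(K * ((L : ℝ) + 1) ^ N * (|ξ| * r) ^ (1 - 2 * s)) := by
  classical
  obtain ⟨hprob, N, a, t, p, -, hN, ha, -, hp, hsum, -, -, -, -, hself⟩ := hμ
  have hM : 0 < M := by linarith
  have : Nonempty (Fin N) := ⟨⟨0, by omega⟩⟩
  obtain ⟨i₀, hi₀⟩ := Finite.exists_min fun i => |a i|
  obtain ⟨i₁, hi₁⟩ := Finite.exists_max fun i => |a i|
  set c := |a i₀| with hc
  have hc0 : 0 < c := (ha i₀).1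
  have hc1 : c ≤ 1 := (ha i₀).2.le
  obtain ⟨δ, K, hδ, hδ1, hK, hsieve⟩ := hmass.exists_sum_sq_measureFourier_le hC hM
    (hsupp.mono fun x hx => ⟨by linarith [hx.1], hx.2⟩)
  -- In units of `1/(|ξ| r)`: `M` bounds the deviation of a piece from its base point, `2δM²/c` the
  -- distance between base points with nearby frequencies, and `1` makes the inequality strict.
  set B := M + 2 * δ * M ^ 2 / c + 1 with hB
  have hB0 : 0 < B := by positivity
  set K₂ := K * (C * B ^ s) * (1 / m + 1) ^ (1 - s) with hK₂
  have hK₂0 : 0 ≤ K₂ := by positivity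
  set K₁ := 2 * Real.pi * M ^ 2 / m ^ 2 with hK₁
  have hK₁0 : 0 ≤ K₁ := by have := Real.pi_pos; positivity
  refine ⟨max K₁ K₂, |a i₁|, N, le_max_of_le_left hK₁0, (ha i₁).1, (ha i₁).2,
    fun ξ r L hr hr1 hXr hXr2 hL => ?_⟩
  have hX : 0 < |ξ| := by
    by_contra! h
    have : |ξ| = 0 := le_antisymm h (abs_nonneg _)
    rw [this] at hXr; norm_num at hXr
  obtain ⟨ι, _, b, u, q, hq, hq1, hdec, hb⟩ := exists_selfSimilar_decomposition
    (fun i => abs_pos.1 (ha i).1) (fun i => (hp i).1) hsum hself hc0.le hc1 hi₀ hi₁ hr.le hr1 L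
  have hbr : ∀ j, |b j| ≤ r := fun j => (hb j).2.2.2.elim id fun h => h.trans hL
  have hae := ae_affine_mem_of_decomposition hq hdec measurableSet_Icc hsupp
  have hex : ∀ j, ∃ x, x ∈ Set.Icc m M ∧ b j * x + u j ∈ Set.Icc m M :=
    fun j => (hsupp.and (hae j)).exists
  choose x hx hy using hex
  set y : ι → ℝ := fun j => b j * x j + u j with hydef
  set η : ι → ℝ := fun j => ξ * b j / y j with hη
  have hsplit : measureFourier (μ.map Real.log) ξ = ∑ j, (q j : ℂ) *
      ∫ x, Complex.exp (-2 * Real.pi * Complex.I * ξ * (Real.log (b j * x + u j) : ℝ)) ∂μ := by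
    have hbdd : ∀ (m : Measure ℝ) [IsFiniteMeasure m], Integrable
        (fun x : ℝ => Complex.exp (-2 * Real.pi * Complex.I * ξ * (Real.log x : ℝ))) m := by
      intro m _
      refine Integrable.mono' (integrable_const (1 : ℝ))
        (Measurable.aestronglyMeasurable (by fun_prop)) (ae_of_all _ fun x => ?_)
      rw [norm_exp_measureFourier]
    rw [measureFourier, integral_map Real.measurable_log.aemeasurable
      (Continuous.aestronglyMeasurable (by fun_prop))]
    conv_lhs => rw [hdec]
    rw [integral_finsetSum_measure]
    · refine Finset.sum_congr rfl fun j _ => ?_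
      rw [integral_smul_measure, ENNReal.toReal_ofReal (hq j).le, integral_map (by fun_prop)
        (Measurable.aestronglyMeasurable (by fun_prop)), Complex.real_smul]
    · intro j _
      have : IsFiniteMeasure (μ.map fun x => b j * x + u j) := inferInstance
      exact (hbdd _).smul_measure ENNReal.ofReal_ne_top
  have hA : ‖measureFourier (μ.map Real.log) ξ‖ ≤
      ∑ j, q j * ‖measureFourier μ (η j)‖ + K₁ * (|ξ| * r ^ 2) := by
    rw [hsplit]
    calc _ ≤ ∑ j, q j * (‖measureFourier μ (η j)‖ + K₁ * (|ξ| * r ^ 2)) := by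
          refine (norm_sum_le _ _).trans (Finset.sum_le_sum fun j _ => ?_)
          rw [norm_mul, Complex.norm_real, Real.norm_of_nonneg (hq j).le]
          exact mul_le_mul_of_nonneg_left (norm_integral_exp_log_affine_le hm hsupp (hae j) (hx j)
            (hy j) (hbr j) ξ) (hq j).le
      _ = _ := by
          simp_rw [mul_add, Finset.sum_add_distrib, ← Finset.sum_mul, hq1, one_mul]
  have hCS : (∑ j, q j * ‖measureFourier μ (η j)‖) ^ 2 ≤ ∑ j, q j * ‖measureFourier μ (η j)‖ ^ 2 := by
    exact Real.pow_arith_mean_le_arith_mean_pow _ _ _ (fun j _ => (hq j).le) hq1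
      (fun _ _ => norm_nonneg _) 2
  have hcount : ∀ v, ∑ j with |η j - v| ≤ δ, q j ≤
      ((L : ℝ) + 1) ^ N * (C * (B / (|ξ| * r)) ^ s) := by
    intro v
    set A := Finset.univ.image fun n : Fin N → Fin (L + 1) => ∏ i, a i ^ (n i : ℕ)
    have hmaps : ∀ j ∈ Finset.univ.filter (fun j => |η j - v| ≤ δ), b j ∈ A := by
      intro j _
      obtain ⟨n, hn, hbn⟩ := (hb j).2.2.1
      exact Finset.mem_image.2 ⟨fun i => ⟨n i, Nat.lt_succ_of_le (hn i)⟩, Finset.mem_univ _,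
        hbn.symm⟩
    -- Group the pieces by the exact value of the ratio: within a group the frequency determines the
    -- position.
    rw [← Finset.sum_fiberwise_of_maps_to hmaps]
    refine (Finset.sum_le_card_nsmul _ _ (C * (B / (|ξ| * r)) ^ s) fun α _ => ?_).trans ?_
    · set J := (Finset.univ.filter fun j => |η j - v| ≤ δ).filter fun j => b j = α with hJ
      rcases J.eq_empty_or_nonempty with hJe | ⟨j₀, hj₀⟩
      · rw [hJe, Finset.sum_empty]; positivity
      · have hball : ∀ j ∈ J, ∀ᵐ z ∂μ, b j * z + u j ∈ Metric.ball (y j₀) (B / (|ξ| * r)) := by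
          intro j hj
          simp only [hJ, Finset.mem_filter, Finset.mem_univ, true_and] at hj hj₀
          filter_upwards [hsupp] with z hz
          have hyj := hy j
          have hyj₀ := hy j₀
          have h1 : |η j - η j₀| ≤ 2 * δ := by
            have := abs_sub_le (η j) v (η j₀)
            rw [abs_sub_comm v] at this
            linarith [hj.1, hj₀.1]
          have hyp : 0 < y j := by linarith [hyj.1]
          have hyp₀ : 0 < y j₀ := by linarith [hyj₀.1]
          have h2 : η j - η j₀ = ξ * α * (y j₀ - y j) / (y j * y j₀) := by
            simp only [hη, hj.2, hj₀.2]
            field_simp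
          have hα : c * r ≤ |α| := by rw [← hj.2]; exact (hb j).2.1
          have h3 : |y j - y j₀| ≤ 2 * δ * M ^ 2 / c / (|ξ| * r) := by
            rw [h2, abs_div, abs_mul, abs_mul, abs_of_pos (mul_pos hyp hyp₀),
              div_le_iff₀ (mul_pos hyp hyp₀), abs_sub_comm] at h1
            rw [div_div, le_div_iff₀ (by positivity)]
            have h4 : y j * y j₀ ≤ M ^ 2 := by
              rw [sq]; exact mul_le_mul hyj.2 hyj₀.2 hyp₀.le hM.le
            calc |y j - y j₀| * (c * (|ξ| * r)) = |ξ| * (c * r) * |y j - y j₀| := by ring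
              _ ≤ |ξ| * |α| * |y j - y j₀| := by gcongr
              _ ≤ 2 * δ * (y j * y j₀) := h1
              _ ≤ 2 * δ * M ^ 2 := by gcongr
          -- The condition `|ξ| r² ≤ 1` says that pieces are no longer than the scale `1/(|ξ| r)`,
          -- up to a constant.
          have h5 : |b j * z + u j - y j| ≤ M / (|ξ| * r) := by
            have : b j * z + u j - y j = b j * (z - x j) := by simp only [hydef]; ring
            rw [this, abs_mul, le_div_iff₀ (by positivity)]
            have h6 : |z - x j| ≤ M := by
              rw [abs_le]; constructor <;> linarith [hz.1, hz.2, (hx j).1, (hx j).2]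
            calc |b j| * |z - x j| * (|ξ| * r) ≤ r * M * (|ξ| * r) := by gcongr; exact hbr j
              _ = (|ξ| * r ^ 2) * M := by ring
              _ ≤ 1 * M := by gcongr
              _ = M := one_mul M
          rw [Metric.mem_ball, Real.dist_eq]
          calc |b j * z + u j - y j₀| ≤ |b j * z + u j - y j| + |y j - y j₀| := abs_sub_le _ _ _
            _ ≤ M / (|ξ| * r) + 2 * δ * M ^ 2 / c / (|ξ| * r) := add_le_add h5 h3
            _ < B / (|ξ| * r) := by
              rw [← add_div]
              exact div_lt_div_of_pos_right (by rw [hB]; linarith) (by positivity)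
        have h7 := (sum_weights_le_measure hq hdec J Metric.isOpen_ball.measurableSet hball).trans
          (hmass (y j₀) (B / (|ξ| * r)) (by positivity))
        exact (ENNReal.ofReal_le_ofReal_iff (by positivity)).1 h7
    · rw [nsmul_eq_mul]
      refine mul_le_mul_of_nonneg_right ?_ (by positivity)
      exact_mod_cast card_image_prod_pow_le a L
  have hT : ∀ j, |η j| ≤ |ξ| * r / m := by
    intro j
    have h1 := hy j
    have hyp : 0 < y j := by linarith [h1.1]
    simp only [hη]
    rw [abs_div, abs_mul, abs_of_pos hyp]
    exact div_le_div₀ (by positivity) (mul_le_mul_of_nonneg_left (hbr j) hX.le) hm h1.1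
  have hfin := hsieve ι η q (|ξ| * r / m) _ (fun j => (hq j).le) hT (by positivity) (by positivity)
    hcount
  have hle : ∑ j, q j * ‖measureFourier μ (η j)‖ ^ 2 ≤
      K₂ * ((L : ℝ) + 1) ^ N * (|ξ| * r) ^ (1 - 2 * s) := by
    refine hfin.trans ?_
    have hZ : 0 < |ξ| * r := by positivity
    have h1 : (|ξ| * r / m + 1) ^ (1 - s) ≤ ((1 / m + 1) * (|ξ| * r)) ^ (1 - s) := by
      refine Real.rpow_le_rpow (by positivity) ?_ (by linarith)
      rw [add_mul, one_div_mul_eq_div]; linarith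
    calc _ ≤ K * (((L : ℝ) + 1) ^ N * (C * (B / (|ξ| * r)) ^ s)) *
          ((1 / m + 1) * (|ξ| * r)) ^ (1 - s) := by gcongr
      _ = _ := by
        rw [Real.div_rpow hB0.le hZ.le, Real.mul_rpow (by positivity) hZ.le,
          show 1 - 2 * s = (1 - s) - s by ring, Real.rpow_sub hZ (1 - s) s, hK₂]
        ring
  refine hA.trans ?_
  rw [add_comm]
  refine add_le_add (mul_le_mul_of_nonneg_right (le_max_left _ _) (by positivity)) ?_
  refine Real.le_sqrt_of_sq_le ((hCS.trans hle).trans ?_)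
  gcongr
  exact le_max_right _ _

/-- With `r = |ξ|^(-β)` the linearisation error is `|ξ|^(1-2β) = |ξ|^(-τ)`. The sieve term has the
same decay with room to spare because `(1-τ)(s-1/2) > 2τ`, which is the hypothesis on `τ`; the
surplus `e` absorbs the power of `L`. -/
theorem IsSelfSimilarMeasure.exists_norm_measureFourier_map_log_le_rpow {μ : Measure ℝ}
    (hμ : IsSelfSimilarMeasure μ) {s C m M : ℝ} (hs : 0 ≤ s) (hs1 : s ≤ 1) (hC : 0 ≤ C)
    (hmass : MassBound μ s C) (hm : 0 < m) (hmM : m ≤ M) (hsupp : ∀ᵐ x ∂μ, x ∈ Set.Icc m M)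
    {τ : ℝ} (hτ0 : 0 < τ) (hτ : τ * (s + 3 / 2) < s - 1 / 2) :
    ∃ K : ℝ, 0 ≤ K ∧ ∀ ξ, ‖measureFourier (μ.map Real.log) ξ‖ ≤ K * (1 + |ξ|) ^ (-τ) := by
  have hprob : IsProbabilityMeasure μ := hμ.1
  obtain ⟨K, ρ, N, hK, hρ0, hρ1, H⟩ :=
    exists_norm_measureFourier_map_log_le hμ hs1 hC hmass hm hmM hsupp
  have hτ1 : τ < 1 := by nlinarith
  set β := (1 + τ) / 2 with hβ
  set e := (1 - τ) * (s - 1 / 2) - 2 * τ with he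
  have he0 : 0 < e := by rw [he]; nlinarith
  set ε := e / (N + 1) with hε
  have hε0 : 0 < ε := by positivity
  have hNε : N * ε ≤ e := by
    rw [hε, mul_div_assoc', div_le_iff₀ (by positivity)]; nlinarith
  have hlρ : Real.log ρ < 0 := Real.log_neg hρ0 hρ1
  set A := β / (ε * -Real.log ρ) + 2 with hA
  have hβ0 : 0 < β := by rw [hβ]; linarith
  have hA0 : 0 < A := by
    have : 0 < ε * -Real.log ρ := mul_pos hε0 (by linarith)
    positivity
  have hlarge : ∀ ξ : ℝ, 1 ≤ |ξ| →
      ‖measureFourier (μ.map Real.log) ξ‖ ≤ (K + √(K * A ^ N)) * |ξ| ^ (-τ) := by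
    intro ξ hξ
    set X := |ξ| with hX
    have hX0 : 0 < X := by linarith
    set r := X ^ (-β) with hr
    have hr0 : 0 < r := by positivity
    have hr1 : r ≤ 1 := Real.rpow_le_one_of_one_le_of_nonpos hξ (by linarith)
    have hXr : X * r = X ^ (1 - β) := by
      rw [hr, sub_eq_add_neg, Real.rpow_add hX0, Real.rpow_one]
    have hXr2 : X * r ^ 2 = X ^ (-τ) := by
      rw [hr, ← Real.rpow_natCast, ← Real.rpow_mul hX0.le, ← Real.rpow_one_add' hX0.le]
      · congr 1; push_cast; rw [hβ]; ring
      · push_cast; rw [hβ]; intro h; linarith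
    set L := ⌈Real.log r / Real.log ρ⌉₊ with hL
    have hLr : ρ ^ L ≤ r := by
      rw [← Real.log_le_log_iff (by positivity) hr0, Real.log_pow]
      have := Nat.le_ceil (Real.log r / Real.log ρ)
      rw [div_le_iff_of_neg hlρ] at this
      exact this
    have h1 := H ξ r L hr0 hr1 (by rw [← hX, hXr]; exact Real.one_le_rpow hξ (by linarith))
      (by rw [← hX, hXr2]; exact Real.rpow_le_one_of_one_le_of_nonpos hξ (by linarith)) hLr
    rw [← hX, hXr2, hXr] at h1
    have hXε : 1 ≤ X ^ ε := Real.one_le_rpow hξ hε0.le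
    -- `L` grows like `log X`, hence slower than `X^ε`. The `2` in `A` covers the rounding in the
    -- ceiling and the added `1`.
    have hL1 : (L : ℝ) + 1 ≤ A * X ^ ε := by
      have h2 : (L : ℝ) < Real.log r / Real.log ρ + 1 := by
        refine Nat.ceil_lt_add_one (div_nonneg_of_nonpos ?_ hlρ.le)
        exact Real.log_nonpos hr0.le hr1
      have h3 : Real.log r / Real.log ρ = β / (-Real.log ρ) * Real.log X := by
        rw [hr, Real.log_rpow hX0]
        field_simp
      have h4 := Real.log_le_rpow_div hX0.le hε0
      have h5 : β / (-Real.log ρ) * Real.log X ≤ β / (-Real.log ρ) * (X ^ ε / ε) :=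
        mul_le_mul_of_nonneg_left h4 (div_nonneg hβ0.le (by linarith))
      have h6 : β / (-Real.log ρ) * (X ^ ε / ε) = β / (ε * -Real.log ρ) * X ^ ε := by
        rw [div_mul_div_comm, mul_comm (-Real.log ρ) ε]
        exact mul_div_right_comm _ _ _
      rw [hA, add_mul]
      linarith
    have h7 : K * ((L : ℝ) + 1) ^ N * (X ^ (1 - β)) ^ (1 - 2 * s) ≤
        K * A ^ N * (X ^ (-τ)) ^ 2 := by
      calc _ ≤ K * (A * X ^ ε) ^ N * (X ^ (1 - β)) ^ (1 - 2 * s) := by gcongr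
        _ = K * A ^ N * X ^ (N * ε + (1 - β) * (1 - 2 * s)) := by
          rw [mul_pow, Real.rpow_add hX0, Real.rpow_mul hX0.le (1 - β), mul_comm (N : ℝ) ε,
            Real.rpow_mul hX0.le ε, Real.rpow_natCast]
          ring
        _ ≤ K * A ^ N * X ^ (-τ * 2) := by
          refine mul_le_mul_of_nonneg_left (Real.rpow_le_rpow_of_exponent_le hξ ?_) (by positivity)
          · have : (1 - β) * (1 - 2 * s) = -e - 2 * τ := by rw [hβ, he]; ring
            linarith
        _ = _ := by
          rw [Real.rpow_mul hX0.le]; norm_num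
    calc _ ≤ _ := h1
      _ ≤ K * X ^ (-τ) + √(K * A ^ N) * X ^ (-τ) := by
        gcongr
        refine (Real.sqrt_le_sqrt h7).trans_eq ?_
        rw [Real.sqrt_mul (by positivity), Real.sqrt_sq (by positivity)]
      _ = _ := by ring
  have h2τ : ∀ ξ : ℝ, 1 ≤ |ξ| → |ξ| ^ (-τ) ≤ 2 ^ τ * (1 + |ξ|) ^ (-τ) := by
    intro ξ hξ
    have h1 : ((1 + |ξ|) / 2) ^ (-τ) = 2 ^ τ * (1 + |ξ|) ^ (-τ) := by
      rw [Real.div_rpow (by positivity) zero_le_two, Real.rpow_neg zero_le_two, div_inv_eq_mul,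
        mul_comm]
    rw [← h1]
    exact Real.rpow_le_rpow_of_nonpos (by positivity) (by linarith) (by linarith)
  refine ⟨(K + √(K * A ^ N) + 1) * 2 ^ τ, by positivity, fun ξ => ?_⟩
  rw [mul_assoc]
  rcases le_or_gt 1 |ξ| with hξ | hξ
  · refine (hlarge ξ hξ).trans ?_
    exact mul_le_mul (by linarith) (h2τ ξ hξ) (by positivity) (by positivity)
  · have hp2 : IsProbabilityMeasure (μ.map Real.log) :=
      Measure.isProbabilityMeasure_map Real.measurable_log.aemeasurable
    have h1 : ‖measureFourier (μ.map Real.log) ξ‖ ≤ 1 :=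
      (norm_measureFourier_le _ ξ).trans (by simp)
    have h2 : (1 : ℝ) ≤ 2 ^ τ * (1 + |ξ|) ^ (-τ) := by
      rw [Real.rpow_neg (by positivity), ← div_eq_mul_inv, one_le_div (by positivity)]
      exact Real.rpow_le_rpow (by positivity) (by linarith) hτ0.le
    have h3 : 1 ≤ K + √(K * A ^ N) + 1 := by
      have := Real.sqrt_nonneg (K * A ^ N)
      linarith
    nlinarith

end Decay

/-! ### Recovering a density from an `L²` or `L¹` Fourier transform. -/

section Density

theorem measure_Icc_le_of_integral_eq {μ ν : Measure ℝ} [IsLocallyFiniteMeasure μ]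
    [IsLocallyFiniteMeasure ν]
    (h : ∀ φ : ℝ → ℝ, ContDiff ℝ ((⊤ : ℕ∞) : WithTop ℕ∞) φ → HasCompactSupport φ →
      ∫ x, φ x ∂μ = ∫ x, φ x ∂ν) {a b : ℝ} (hab : a ≤ b) :
    μ (Set.Icc a b) ≤ ν (Set.Icc a b) := by
  have key : ∀ n : ℕ, μ (Set.Icc a b) ≤ ν (Set.Icc (a - 2 / (n + 1)) (b + 2 / (n + 1))) := by
    intro n
    set ε : ℝ := 1 / (n + 1) with hε
    have hε2 : (2 : ℝ) / (n + 1) = 2 * ε := by rw [hε]; ring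
    have hε0 : 0 < ε := by positivity
    rw [hε2]
    -- The inner radius is enlarged by `ε` so that it stays positive when `a = b`.
    let φ : ContDiffBump ((a + b) / 2) := ⟨(b - a) / 2 + ε, (b - a) / 2 + 2 * ε,
      by linarith, by linarith⟩
    have hφi : ∀ (m : Measure ℝ) [IsLocallyFiniteMeasure m], Integrable φ m := fun m _ =>
      φ.continuous.integrable_of_hasCompactSupport φ.hasCompactSupport
    have h1 : μ (Set.Icc a b) ≤ ENNReal.ofReal (∫ x, φ x ∂μ) := by
      rw [ofReal_integral_eq_lintegral_ofReal (hφi μ) (ae_of_all _ fun x => φ.nonneg),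
        ← lintegral_indicator_one measurableSet_Icc]
      refine lintegral_mono fun x => ?_
      refine Set.indicator_le' (fun x hx => ?_) (fun x _ => (zero_le : (0 : ℝ≥0∞) ≤ ENNReal.ofReal (φ x))) x
      rw [φ.one_of_mem_closedBall]
      · simp
      · rw [Metric.mem_closedBall, Real.dist_eq, abs_le]
        change -((b - a) / 2 + ε) ≤ _ ∧ _ ≤ (b - a) / 2 + ε
        constructor <;> linarith [hx.1, hx.2]
    refine h1.trans ?_
    rw [h φ φ.contDiff φ.hasCompactSupport, ofReal_integral_eq_lintegral_ofReal (hφi ν)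
      (ae_of_all _ fun x => φ.nonneg), ← lintegral_indicator_one measurableSet_Icc]
    refine lintegral_mono fun x => ?_
    refine Set.le_indicator (f := fun x => ENNReal.ofReal (φ x)) (fun x _ => ?_) (fun x hx => ?_) x
    · simpa using φ.le_one
    · rw [φ.zero_of_le_dist, ENNReal.ofReal_zero]
      change (b - a) / 2 + 2 * ε ≤ _
      rw [Real.dist_eq]
      by_contra! hlt
      rw [abs_lt] at hlt
      exact hx ⟨by linarith [hlt.1], by linarith [hlt.2]⟩
  have hlim : Tendsto (fun n : ℕ => ν (Set.Icc (a - 2 / ((n : ℝ) + 1)) (b + 2 / ((n : ℝ) + 1)))) atTop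
      (𝓝 (ν (⋂ n : ℕ, Set.Icc (a - 2 / ((n : ℝ) + 1)) (b + 2 / ((n : ℝ) + 1))))) := by
    refine tendsto_measure_iInter_atTop (fun n => measurableSet_Icc.nullMeasurableSet) ?_
      ⟨0, isCompact_Icc.measure_lt_top.ne⟩
    intro i j hij
    have : (2 : ℝ) / (j + 1) ≤ 2 / (i + 1) := by
      have : (i : ℝ) ≤ j := by exact_mod_cast hij
      gcongr
    exact Set.Icc_subset_Icc (by linarith) (by linarith)
  have hinter : (⋂ n : ℕ, Set.Icc (a - 2 / ((n : ℝ) + 1)) (b + 2 / ((n : ℝ) + 1))) ⊆ Set.Icc a b := by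
    intro x hx
    have ht : Tendsto (fun n : ℕ => 2 / ((n : ℝ) + 1)) atTop (𝓝 0) :=
      tendsto_const_nhds.div_atTop (tendsto_natCast_atTop_atTop.atTop_add tendsto_const_nhds)
    have hx' := fun n => Set.mem_iInter.1 hx n
    constructor
    · have := tendsto_const_nhds (x := a) |>.sub ht
      rw [sub_zero] at this
      exact le_of_tendsto this (Eventually.of_forall fun n => (hx' n).1)
    · have := tendsto_const_nhds (x := b) |>.add ht
      rw [add_zero] at this
      exact ge_of_tendsto this (Eventually.of_forall fun n => (hx' n).2)
  exact (ge_of_tendsto hlim (Eventually.of_forall key)).trans (measure_mono hinter)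

theorem Measure.ext_of_integral_contDiff_eq {μ ν : Measure ℝ} [IsLocallyFiniteMeasure μ]
    [IsLocallyFiniteMeasure ν]
    (h : ∀ φ : ℝ → ℝ, ContDiff ℝ ((⊤ : ℕ∞) : WithTop ℕ∞) φ → HasCompactSupport φ →
      ∫ x, φ x ∂μ = ∫ x, φ x ∂ν) : μ = ν :=
  Measure.ext_of_Icc _ _ fun _ _ hab => le_antisymm (measure_Icc_le_of_integral_eq h hab)
    (measure_Icc_le_of_integral_eq (fun φ h1 h2 => (h φ h1 h2).symm) hab)

theorem isLocallyFiniteMeasure_withDensity_ofReal_of_locallyIntegrable {g : ℝ → ℝ}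
    (hg : LocallyIntegrable g) :
    IsLocallyFiniteMeasure (volume.withDensity fun x => ENNReal.ofReal (g x)) := by
  refine ⟨fun x => ?_⟩
  refine ⟨Metric.closedBall x 1, Metric.closedBall_mem_nhds x one_pos, ?_⟩
  rw [withDensity_apply _ Metric.isClosed_closedBall.measurableSet]
  refine lt_of_le_of_lt (lintegral_mono fun x => ?_)
    (hg.integrableOn_isCompact (isCompact_closedBall x 1)).hasFiniteIntegral
  exact Real.ofReal_le_enorm _

/-- A measure whose integrals against test functions are given by a locally integrable function
has that function as its density. -/
theorem eq_withDensity_of_integral_contDiff_eq {P : Measure ℝ} [IsFiniteMeasure P] {g : ℝ → ℝ}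
    (hgm : Measurable g) (hg : LocallyIntegrable g)
    (h : ∀ φ : ℝ → ℝ, ContDiff ℝ ((⊤ : ℕ∞) : WithTop ℕ∞) φ → HasCompactSupport φ →
      ∫ x, φ x ∂P = ∫ x, φ x * g x) :
    P = volume.withDensity fun x => ENNReal.ofReal (g x) := by
  have hW1 := isLocallyFiniteMeasure_withDensity_ofReal_of_locallyIntegrable hg
  have hW2 := isLocallyFiniteMeasure_withDensity_ofReal_of_locallyIntegrable hg.neg
  set W1 := volume.withDensity fun x => ENNReal.ofReal (g x) with hW1d
  set W2 := volume.withDensity fun x => ENNReal.ofReal ((-g) x) with hW2d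
  have hPW : IsLocallyFiniteMeasure (P + W2) := by
    refine ⟨fun x => ?_⟩
    obtain ⟨s, hs, hs'⟩ := W2.finiteAt_nhds x
    exact ⟨s, hs, by rw [Measure.add_apply]; exact ENNReal.add_lt_top.2 ⟨measure_lt_top P s, hs'⟩⟩
  -- The sign of `g` is not known beforehand: the identity is stated as `P + g⁻ = g⁺` between
  -- positive measures. As `W1` vanishes on `{g < 0}`, so does `W2`, and hence `W2 = 0`.
  have hsum : P + W2 = W1 := by
    refine Measure.ext_of_integral_contDiff_eq fun φ hφ hφc => ?_
    have hφi : ∀ (m : Measure ℝ) [IsLocallyFiniteMeasure m], Integrable φ m := fun m _ =>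
      hφ.continuous.integrable_of_hasCompactSupport hφc
    have hi : ∀ f : ℝ → ℝ, LocallyIntegrable f → Integrable (fun x => φ x * f x) := by
      intro f hf
      have := hf.integrable_smul_left_of_hasCompactSupport hφ.continuous hφc
      exact this
    rw [integral_add_measure (hφi _) (hφi _), h φ hφ hφc, hW1d, hW2d,
      integral_withDensity_eq_integral_toReal_smul (by fun_prop) (by simp),
      integral_withDensity_eq_integral_toReal_smul hgm.ennreal_ofReal (by simp)]
    have e1 : ∀ x, (ENNReal.ofReal (g x)).toReal • φ x
        = φ x * g x + (ENNReal.ofReal ((-g) x)).toReal • φ x := by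
      intro x
      simp only [ENNReal.toReal_ofReal', smul_eq_mul, Pi.neg_apply]
      rcases le_total 0 (g x) with hx | hx
      · rw [max_eq_left hx, max_eq_right (by linarith)]; ring
      · rw [max_eq_right hx, max_eq_left (by linarith)]; ring
    simp_rw [e1]
    rw [integral_add (hi g hg)]
    have := (hφi W2)
    rw [hW2d, integrable_withDensity_iff_integrable_smul' (by fun_prop) (by simp)] at this
    exact this
  have hE : MeasurableSet {x | g x < 0} := measurableSet_lt hgm measurable_const
  have h1 : W1 {x | g x < 0} = 0 := by
    rw [hW1d, withDensity_apply _ hE]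
    rw [setLIntegral_congr_fun hE (g := fun _ => 0)]
    · simp
    · intro x hx
      exact ENNReal.ofReal_of_nonpos (le_of_lt hx)
  have h2 : W2 {x | g x < 0} = 0 := by
    rw [← hsum, Measure.add_apply] at h1
    exact (add_eq_zero.1 h1).2
  have h3 : W2 {x | g x < 0}ᶜ = 0 := by
    rw [hW2d, withDensity_apply _ hE.compl]
    rw [setLIntegral_congr_fun hE.compl (g := fun _ => 0)]
    · simp
    · intro x hx
      have : 0 ≤ g x := not_lt.1 hx
      exact ENNReal.ofReal_of_nonpos (by simpa using this)
  have h4 : W2 = 0 := by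
    rw [← Measure.measure_univ_eq_zero, ← Set.union_compl_self {x | g x < 0}]
    exact measure_union_null h2 h3
  rw [← hsum, h4, add_zero]

theorem eq_withDensity_re_of_integral_schwartz_eq {P : Measure ℝ} [IsFiniteMeasure P] {G : ℝ → ℂ}
    (hGm : Measurable G) (hG : LocallyIntegrable G)
    (h : ∀ φ : 𝓢(ℝ, ℂ), ∫ x, φ x ∂P = ∫ x, φ x * G x) :
    P = volume.withDensity fun x => ENNReal.ofReal (G x).re := by
  refine eq_withDensity_of_integral_contDiff_eq (Complex.measurable_re.comp hGm) ?_ ?_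
  · intro x
    obtain ⟨s, hs, hsi⟩ := hG x
    exact ⟨s, hs, hsi.re⟩
  · intro φ hφ hφc
    have hc : HasCompactSupport fun x => (φ x : ℂ) := hφc.comp_left (g := Complex.ofReal) rfl
    have h1 := h (hc.toSchwartzMap (Complex.ofRealCLM.contDiff.comp hφ))
    have h2 : ∀ x, (hc.toSchwartzMap (Complex.ofRealCLM.contDiff.comp hφ)) x = (φ x : ℂ) :=
      fun _ => rfl
    simp_rw [h2] at h1
    rw [integral_complex_ofReal] at h1
    have hi : Integrable (fun x => (φ x : ℂ) * G x) :=
      hG.integrable_smul_left_of_hasCompactSupport (g := fun x => (φ x : ℂ))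
        (Complex.continuous_ofReal.comp hφ.continuous) hc
    have h3 := congrArg Complex.re h1
    rw [Complex.ofReal_re] at h3
    rw [h3]
    have h4 := integral_re hi
    simp only [RCLike.re_eq_complex_re] at h4
    rw [← h4]
    simp

/-- The density is the `L²` inverse transform; testing against Schwartz functions as tempered
distributions identifies it with `P`. -/
theorem exists_memLp_two_density_of_measureFourier {P : Measure ℝ} [IsFiniteMeasure P]
    (h : MemLp (measureFourier P) 2 volume) : ∃ g : ℝ → ℝ, Measurable g ∧ (∀ x, 0 ≤ g x) ∧
      MemLp g 2 volume ∧ P = volume.withDensity fun x => ENNReal.ofReal (g x) := by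
  set G : Lp ℂ 2 (volume : Measure ℝ) := 𝓕⁻ (h.toLp (measureFourier P)) with hG
  have hGL : MemLp G 2 volume := Lp.memLp G
  have hP := eq_withDensity_re_of_integral_schwartz_eq (P := P) (Lp.stronglyMeasurable G).measurable
    (hGL.locallyIntegrable (by norm_num)) (fun φ => by
      have h1 : ∫ x, φ x • G x = Lp.toTemperedDistribution G φ :=
        (Lp.toTemperedDistribution_apply G φ).symm
      simp only [smul_eq_mul] at h1
      rw [h1, hG, ← Lp.fourierInv_toTemperedDistribution_eq, TemperedDistribution.fourierInv_apply,
        Lp.toTemperedDistribution_apply]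
      have h2 : ∫ x, (𝓕⁻ φ) x • (h.toLp (measureFourier P)) x = ∫ x, measureFourier P x * (𝓕⁻ φ) x := by
        refine integral_congr_ae ?_
        filter_upwards [h.coeFn_toLp] with x hx
        rw [hx, smul_eq_mul, mul_comm]
      rw [h2, integral_measureFourier_mul P (𝓕⁻ φ).integrable, ← SchwartzMap.fourier_coe,
        FourierTransform.fourier_fourierInv_eq])
  have hm : Measurable fun x => (G x).re :=
    Complex.measurable_re.comp (Lp.stronglyMeasurable G).measurable
  refine ⟨fun x => max (G x).re 0, hm.max measurable_const, fun x => le_max_right _ _, ?_, ?_⟩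
  · exact hGL.re.pos_part
  · refine hP.trans ?_
    congr 1; ext x
    simp [ENNReal.ofReal_max]

theorem exists_continuous_density_of_measureFourier {P : Measure ℝ} [IsFiniteMeasure P]
    (h : Integrable (measureFourier P)) : ∃ g : ℝ → ℝ, Continuous g ∧ (∀ x, 0 ≤ g x) ∧
      P = volume.withDensity fun x => ENNReal.ofReal (g x) := by
  set G : ℝ → ℂ := 𝓕⁻ (measureFourier P) with hG
  have hGc : Continuous G :=
    VectorFourier.fourierIntegral_continuous (L := -innerₗ ℝ) Real.continuous_fourierChar
      (by simp only [LinearMap.neg_apply, innerₗ_apply_apply]; fun_prop) h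
  have hP := eq_withDensity_re_of_integral_schwartz_eq (P := P) hGc.measurable
    hGc.locallyIntegrable (fun φ => by
      have h1 := VectorFourier.integral_fourierIntegral_smul_eq_flip (L := -innerₗ ℝ) (μ := volume)
        (ν := volume) (e := Real.fourierChar) (f := φ) (g := measureFourier P)
        Real.continuous_fourierChar (by simp only [LinearMap.neg_apply, innerₗ_apply_apply]; fun_prop) φ.integrable h
      have h2 : (-innerₗ ℝ : ℝ →ₗ[ℝ] ℝ →ₗ[ℝ] ℝ).flip = -innerₗ ℝ := by
        ext; simp
      rw [h2] at h1
      have h3 : ∫ x, φ x * G x = ∫ x, (𝓕⁻ φ) x * measureFourier P x := by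
        rw [SchwartzMap.fourierInv_coe]; exact h1.symm
      rw [h3]
      simp_rw [mul_comm _ (measureFourier P _)]
      rw [integral_measureFourier_mul P (𝓕⁻ φ).integrable, ← SchwartzMap.fourier_coe,
        FourierTransform.fourier_fourierInv_eq])
  refine ⟨fun x => max (G x).re 0, (Complex.continuous_re.comp hGc).max continuous_const,
    fun x => le_max_right _ _, ?_⟩
  refine hP.trans ?_
  congr 1; ext x
  simp [ENNReal.ofReal_max]

end Density

/-! ### Transfer between a measure on the positive half-line and its logarithm. -/

section LogCoordinates

/-- On `[m, M]` one has `|z - y| ≤ M |log z - log y|`, and two points of the preimage of a ball of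
radius `r` have logarithms less than `2r` apart. -/
theorem MassBound.map_log {μ : Measure ℝ} {s C m M : ℝ} (h : MassBound μ s C)
    (hm : 0 < m) (hmM : m ≤ M) (hμ : ∀ᵐ x ∂μ, x ∈ Set.Icc m M) :
    MassBound (μ.map Real.log) s (C * (2 * M) ^ s) := by
  intro x r hr
  have hM : 0 < M := by linarith
  rw [Measure.map_apply Real.measurable_log Metric.isOpen_ball.measurableSet]
  have hnull : μ (Set.Icc m M)ᶜ = 0 := hμ
  by_cases hne : (Real.log ⁻¹' Metric.ball x r ∩ Set.Icc m M).Nonempty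
  · obtain ⟨y, hy, hyI⟩ := hne
    have hsub : Real.log ⁻¹' Metric.ball x r ⊆ Metric.ball y (2 * M * r) ∪ (Set.Icc m M)ᶜ := by
      intro z hz
      by_cases hzI : z ∈ Set.Icc m M
      · left
        have hlip : ∀ u v : ℝ, u ∈ Set.Icc m M → v ∈ Set.Icc m M →
            u - v ≤ M * |Real.log u - Real.log v| := by
          intro u v hu hv
          have hu0 : 0 < u := by linarith [hu.1]
          have hv0 : 0 < v := by linarith [hv.1]
          have h1 := Real.one_sub_inv_le_log_of_pos (div_pos hu0 hv0)
          rw [Real.log_div hu0.ne' hv0.ne', inv_div, one_sub_div hu0.ne', div_le_iff₀ hu0] at h1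
          calc u - v ≤ (Real.log u - Real.log v) * u := h1
            _ ≤ |Real.log u - Real.log v| * M :=
              mul_le_mul (le_abs_self _) hu.2 hu0.le (abs_nonneg _)
            _ = _ := mul_comm _ _
        have h1 : |Real.log z - Real.log y| < 2 * r := by
          rw [Set.mem_preimage, Metric.mem_ball, Real.dist_eq] at hz hy
          have := abs_sub_le (Real.log z) x (Real.log y)
          rw [abs_sub_comm x] at this
          linarith
        have h2 := hlip z y hzI hyI
        have h3 := hlip y z hyI hzI
        rw [abs_sub_comm] at h3
        rw [Metric.mem_ball, Real.dist_eq]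
        have h4 : |z - y| ≤ M * |Real.log z - Real.log y| := abs_le.2 ⟨by linarith, h2⟩
        nlinarith
      · exact Or.inr hzI
    refine (measure_mono hsub).trans ((measure_union_le _ _).trans ?_)
    rw [hnull, add_zero]
    refine (h y _ (by positivity)).trans_eq ?_
    rw [Real.mul_rpow (by positivity) hr.le, mul_assoc]
  · have : μ (Real.log ⁻¹' Metric.ball x r) = 0 := by
      refine measure_mono_null (t := (Set.Icc m M)ᶜ) ?_ hnull
      exact fun z hz hzI => hne ⟨z, hz, hzI⟩
    rw [this]; exact zero_le

theorem ae_mem_Icc_mconv {μ ν : Measure ℝ} [IsProbabilityMeasure μ] [IsProbabilityMeasure ν]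
    {m M m' M' : ℝ} (hm : 0 < m) (hm' : 0 < m') (hμ : ∀ᵐ x ∂μ, x ∈ Set.Icc m M)
    (hν : ∀ᵐ x ∂ν, x ∈ Set.Icc m' M') : ∀ᵐ x ∂(Measure.mconv μ ν), x ∈ Set.Icc (m * m') (M * M') := by
  refine (ae_map_iff (p := fun x => x ∈ Set.Icc (m * m') (M * M')) (by fun_prop)
    measurableSet_Icc).2 ?_
  have h1 := Measure.quasiMeasurePreserving_fst (μ := μ) (ν := ν) |>.ae hμ
  have h2 := Measure.quasiMeasurePreserving_snd (μ := μ) (ν := ν) |>.ae hν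
  filter_upwards [h1, h2] with z hz hz'
  exact ⟨mul_le_mul hz.1 hz'.1 hm'.le (by linarith [hz.1]),
    mul_le_mul hz.2 hz'.2 (by linarith [hz'.1]) (by linarith [hz.1, hz.2])⟩

theorem measureFourier_map_log_mconv {μ ν : Measure ℝ} [IsProbabilityMeasure μ]
    [IsProbabilityMeasure ν] {m M m' M' : ℝ} (hm : 0 < m) (hm' : 0 < m')
    (hμ : ∀ᵐ x ∂μ, x ∈ Set.Icc m M) (hν : ∀ᵐ x ∂ν, x ∈ Set.Icc m' M') (ξ : ℝ) :
    measureFourier ((Measure.mconv μ ν).map Real.log) ξ =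
      measureFourier (μ.map Real.log) ξ * measureFourier (ν.map Real.log) ξ := by
  unfold measureFourier
  rw [integral_map Real.measurable_log.aemeasurable
      (Continuous.aestronglyMeasurable (by fun_prop)),
    integral_map Real.measurable_log.aemeasurable (Continuous.aestronglyMeasurable (by fun_prop)),
    integral_map Real.measurable_log.aemeasurable (Continuous.aestronglyMeasurable (by fun_prop)),
    Measure.mconv, integral_map (by fun_prop) (Measurable.aestronglyMeasurable (by fun_prop)),
    ← integral_prod_mul]
  have h1 := Measure.quasiMeasurePreserving_fst (μ := μ) (ν := ν) |>.ae hμ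
  have h2 := Measure.quasiMeasurePreserving_snd (μ := μ) (ν := ν) |>.ae hν
  refine integral_congr_ae ?_
  filter_upwards [h1, h2] with z hz hz'
  rw [← Complex.exp_add, Real.log_mul (by linarith [hz.1]) (by linarith [hz'.1])]
  congr 1
  push_cast
  ring

/-- Change of variables `z = exp u`. The cut-off at `m` discards `z ≤ 0`, where `h (log z) / z` has
no meaning for `Q`, and keeps `1/z` bounded. -/
theorem eq_withDensity_of_map_log_eq {Q : Measure ℝ} {m M : ℝ} (hm : 0 < m)
    (hQ : ∀ᵐ x ∂Q, x ∈ Set.Icc m M) {h : ℝ → ℝ}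
    (hd : Q.map Real.log = volume.withDensity fun x => ENNReal.ofReal (h x)) :
    Q = volume.withDensity fun z =>
      ENNReal.ofReal ((Set.Ici m).indicator (fun z => h (Real.log z) / z) z) := by
  ext E hE
  set s := Real.exp ⁻¹' (E ∩ Set.Ici m) with hs
  have hsm : MeasurableSet s := Real.measurable_exp (hE.inter measurableSet_Ici)
  have himg : Real.exp '' s = E ∩ Set.Ici m := by
    refine Set.image_preimage_eq_of_subset fun z hz => ?_
    rw [Real.range_exp]
    exact lt_of_lt_of_le hm hz.2
  have h1 : Q E = Q.map Real.log s := by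
    rw [Measure.map_apply Real.measurable_log hsm]
    refine measure_congr ?_
    filter_upwards [hQ] with z hz
    have : Real.exp (Real.log z) = z := Real.exp_log (by linarith [hz.1])
    apply propext
    change z ∈ E ↔ Real.exp (Real.log z) ∈ E ∩ Set.Ici m
    rw [this]
    exact ⟨fun h => ⟨h, hz.1⟩, fun h => h.1⟩
  have h2 := lintegral_image_eq_lintegral_abs_deriv_mul (s := s) (f := Real.exp) (f' := Real.exp) hsm
    (fun x _ => (Real.hasDerivAt_exp x).hasDerivWithinAt) Real.exp_injective.injOn
    (fun z => ENNReal.ofReal (h (Real.log z) / z))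
  have h3 : ∀ u, ENNReal.ofReal |Real.exp u| * ENNReal.ofReal (h (Real.log (Real.exp u)) / Real.exp u)
      = ENNReal.ofReal (h u) := by
    intro u
    rw [abs_of_pos (Real.exp_pos u), ← ENNReal.ofReal_mul (Real.exp_pos u).le, Real.log_exp,
      mul_div_cancel₀ _ (Real.exp_pos u).ne']
  simp_rw [h3] at h2
  rw [himg] at h2
  rw [h1, hd, withDensity_apply _ hsm, withDensity_apply _ hE, ← h2]
  have h4 : ∀ z, ENNReal.ofReal ((Set.Ici m).indicator (fun z => h (Real.log z) / z) z)
      = (Set.Ici m).indicator (fun z => ENNReal.ofReal (h (Real.log z) / z)) z := by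
    intro z
    by_cases hz : z ∈ Set.Ici m <;> simp [hz]
  simp_rw [h4]
  rw [setLIntegral_indicator measurableSet_Ici, Set.inter_comm]

theorem memLp_two_indicator_comp_log_div {m : ℝ} (hm : 0 < m) {h : ℝ → ℝ} (hmeas : Measurable h)
    (hL : MemLp h 2 volume) :
    MemLp ((Set.Ici m).indicator fun z => h (Real.log z) / z) 2 volume := by
  set g := (Set.Ici m).indicator fun z => h (Real.log z) / z with hg
  have hgm : Measurable g :=
    ((hmeas.comp Real.measurable_log).div measurable_id).indicator measurableSet_Ici
  rw [memLp_two_iff_integrable_sq hgm.aestronglyMeasurable]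
  have hhi := (memLp_two_iff_integrable_sq hL.1).1 hL
  refine ⟨(hgm.pow_const 2).aestronglyMeasurable, ?_⟩
  rw [hasFiniteIntegral_iff_ofReal (ae_of_all _ fun _ => sq_nonneg _)]
  have hfin := (hhi.const_mul m⁻¹).2
  rw [hasFiniteIntegral_iff_ofReal (ae_of_all _ fun _ => by positivity)] at hfin
  refine lt_of_le_of_lt ?_ hfin
  have h2 := lintegral_image_eq_lintegral_abs_deriv_mul (s := Set.univ) (f := Real.exp)
    (f' := Real.exp) MeasurableSet.univ
    (fun x _ => (Real.hasDerivAt_exp x).hasDerivWithinAt) Real.exp_injective.injOn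
    (fun z => ENNReal.ofReal (g z ^ 2))
  rw [Set.image_univ, Real.range_exp, setLIntegral_univ] at h2
  have h3 : ∫⁻ z, ENNReal.ofReal (g z ^ 2) = ∫⁻ z in Set.Ioi 0, ENNReal.ofReal (g z ^ 2) := by
    rw [← lintegral_indicator measurableSet_Ioi]
    congr 1; ext z
    by_cases hz : z ∈ Set.Ioi (0 : ℝ)
    · rw [Set.indicator_of_mem hz]
    · have : z ∉ Set.Ici m := fun h' => hz (lt_of_lt_of_le hm h')
      rw [Set.indicator_of_notMem hz, hg, Set.indicator_of_notMem this]
      simp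
  rw [h3, h2]
  refine lintegral_mono fun u => ?_
  rw [← ENNReal.ofReal_mul (abs_nonneg _)]
  apply ENNReal.ofReal_le_ofReal
  have hu := Real.exp_pos u
  rw [abs_of_pos hu]
  by_cases hmu : Real.exp u ∈ Set.Ici m
  · rw [hg, Set.indicator_of_mem hmu, Real.log_exp]
    -- After the Jacobian one factor `exp (-u)` is left, at most `1/m` on the cut-off region.
    have : Real.exp u * (h u / Real.exp u) ^ 2 = (Real.exp u)⁻¹ * h u ^ 2 := by
      field_simp
    rw [this]
    gcongr
    exact hmu
  · rw [hg, Set.indicator_of_notMem hmu]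
    simp; positivity

theorem continuous_indicator_comp_log_div {Q : Measure ℝ} {m M : ℝ} (hm : 0 < m)
    (hQ : ∀ᵐ x ∂Q, x ∈ Set.Icc m M) {h : ℝ → ℝ} (hc : Continuous h) (h0 : ∀ x, 0 ≤ h x)
    (hd : Q.map Real.log = volume.withDensity fun x => ENNReal.ofReal (h x)) :
    Continuous ((Set.Ici m).indicator fun z => h (Real.log z) / z) := by
  have hzero : ∫⁻ u in Set.Iio (Real.log m), ENNReal.ofReal (h u) = 0 := by
    rw [← withDensity_apply _ measurableSet_Iio, ← hd, Measure.map_apply Real.measurable_log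
      measurableSet_Iio]
    refine measure_mono_null (t := (Set.Icc m M)ᶜ) ?_ hQ
    intro z hz hzI
    exact absurd (Real.log_le_log hm hzI.1) (not_le.2 hz)
  rw [lintegral_eq_zero_iff (hc.measurable.ennreal_ofReal)] at hzero
  have hae : h =ᵐ[volume.restrict (Set.Iio (Real.log m))] fun _ => 0 := by
    filter_upwards [hzero] with u hu
    exact le_antisymm (ENNReal.ofReal_eq_zero.1 hu) (h0 u)
  have heq := Measure.eqOn_open_of_ae_eq hae isOpen_Iio hc.continuousOn continuousOn_const
  -- `h` vanishes to the left of `log m` and is continuous, so the cut-off at `m` creates no jump.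
  have hm0 : h (Real.log m) = 0 :=
    (heq.closure hc continuous_const) (by rw [closure_Iio]; exact Set.self_mem_Iic)
  have hfun : ((Set.Ici m).indicator fun z => h (Real.log z) / z)
      = fun z => h (Real.log (max z m)) / max z m := by
    ext z
    by_cases hz : z ∈ Set.Ici m
    · rw [Set.indicator_of_mem hz, max_eq_left hz]
    · rw [Set.indicator_of_notMem hz, max_eq_right (not_le.1 hz).le, hm0, zero_div]
  rw [hfun]
  have hpos : ∀ z : ℝ, max z m ≠ 0 := fun z => (lt_of_lt_of_le hm (le_max_right z m)).ne'
  have hmax : Continuous fun z : ℝ => max z m := continuous_id.max continuous_const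
  exact (hc.comp (hmax.log hpos)).div hmax hpos

theorem indicator_comp_log_div_nonneg {m : ℝ} (hm : 0 < m) {h : ℝ → ℝ} (h0 : ∀ x, 0 ≤ h x) (z : ℝ) :
    0 ≤ (Set.Ici m).indicator (fun z => h (Real.log z) / z) z := by
  refine Set.indicator_nonneg (fun z hz => div_nonneg (h0 _) ?_) z
  exact hm.le.trans hz

theorem exists_memLp_two_density_of_measureFourier_map_log {Q : Measure ℝ} [IsProbabilityMeasure Q]
    {m M : ℝ} (hm : 0 < m) (hQ : ∀ᵐ x ∂Q, x ∈ Set.Icc m M)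
    (h : MemLp (measureFourier (Q.map Real.log)) 2 volume) :
    ∃ g : ℝ → ℝ, (∀ x, 0 ≤ g x) ∧ MemLp g 2 volume ∧
      Q = volume.withDensity (fun x => ENNReal.ofReal (g x)) := by
  obtain ⟨f, hf, hf0, hfL, hd⟩ := exists_memLp_two_density_of_measureFourier h
  exact ⟨_, indicator_comp_log_div_nonneg hm hf0, memLp_two_indicator_comp_log_div hm hf hfL,
    eq_withDensity_of_map_log_eq hm hQ hd⟩

theorem exists_continuous_density_of_measureFourier_map_log {Q : Measure ℝ}
    [IsProbabilityMeasure Q] {m M : ℝ} (hm : 0 < m) (hQ : ∀ᵐ x ∂Q, x ∈ Set.Icc m M)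
    (h : Integrable (measureFourier (Q.map Real.log))) :
    ∃ g : ℝ → ℝ, (∀ x, 0 ≤ g x) ∧ Continuous g ∧
      Q = volume.withDensity (fun x => ENNReal.ofReal (g x)) := by
  obtain ⟨f, hf, hf0, hd⟩ := exists_continuous_density_of_measureFourier h
  exact ⟨_, indicator_comp_log_div_nonneg hm hf0, continuous_indicator_comp_log_div hm hQ hf hf0 hd,
    eq_withDensity_of_map_log_eq hm hQ hd⟩

end LogCoordinates

/-! ### Combining average and pointwise decay. -/

section Convolution

theorem MassBound.integrable_sq_measureFourier_mul_rpow {P : Measure ℝ} [IsFiniteMeasure P]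
    {s C q : ℝ} (hC : 0 ≤ C) (h : MassBound P s C) (hq0 : 0 ≤ q) (hq : 1 - s < q) :
    Integrable fun ξ => ‖measureFourier P ξ‖ ^ 2 * (1 + |ξ|) ^ (-q) := by
  obtain ⟨K, hK, H⟩ := h.exists_energy_le hC
  have hc : Continuous fun ξ => ‖measureFourier P ξ‖ ^ 2 := (continuous_measureFourier P).norm.pow 2
  have hw : Measurable fun ξ : ℝ => (1 + |ξ|) ^ (-q) := by fun_prop
  have hfin := lintegral_one_add_abs_rpow_lt_top
    (m := volume.withDensity fun ξ => ENNReal.ofReal (‖measureFourier P ξ‖ ^ 2)) hK hq0 hq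
    (fun r hr => by
      rw [withDensity_apply _ Metric.isOpen_ball.measurableSet]
      exact H r (by linarith))
  rw [lintegral_withDensity_eq_lintegral_mul _ hc.measurable.ennreal_ofReal hw.ennreal_ofReal] at hfin
  refine ⟨(hc.measurable.mul hw).aestronglyMeasurable, ?_⟩
  rw [hasFiniteIntegral_iff_ofReal (ae_of_all _ fun _ => by positivity)]
  refine lt_of_le_of_lt (lintegral_mono fun ξ => ?_) hfin
  rw [Pi.mul_apply, ENNReal.ofReal_mul (by positivity)]

theorem memLp_two_mul_measureFourier {P Q : Measure ℝ} [IsFiniteMeasure P] [IsFiniteMeasure Q]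
    {s C K τ : ℝ} (hC : 0 ≤ C) (hQ : MassBound Q s C) (hτ0 : 0 ≤ τ) (hτ : 1 - s < 2 * τ)
    (hP : ∀ ξ, ‖measureFourier P ξ‖ ≤ K * (1 + |ξ|) ^ (-τ)) :
    MemLp (fun ξ => measureFourier P ξ * measureFourier Q ξ) 2 volume := by
  have hc : Continuous fun ξ => measureFourier P ξ * measureFourier Q ξ :=
    (continuous_measureFourier P).mul (continuous_measureFourier Q)
  rw [memLp_two_iff_integrable_sq_norm hc.aestronglyMeasurable]
  refine Integrable.mono' ((hQ.integrable_sq_measureFourier_mul_rpow hC (q := 2 * τ) (by linarith)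
    hτ).const_mul (K ^ 2)) (hc.norm.pow 2).aestronglyMeasurable (ae_of_all _ fun ξ => ?_)
  rw [Real.norm_of_nonneg (by positivity), norm_mul, mul_pow]
  have h1 : ((1 + |ξ|) ^ (-τ)) ^ 2 = (1 + |ξ|) ^ (-(2 * τ)) := by
    rw [← Real.rpow_natCast, ← Real.rpow_mul (by positivity)]
    congr 1; push_cast; ring
  calc _ ≤ (K * (1 + |ξ|) ^ (-τ)) ^ 2 * ‖measureFourier Q ξ‖ ^ 2 := by
        gcongr; exact hP ξ
    _ = _ := by rw [mul_pow, h1]; ring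

theorem integrable_mul_mul_measureFourier {P Q S : Measure ℝ} [IsFiniteMeasure P]
    [IsFiniteMeasure Q] [IsFiniteMeasure S] {s C s' C' K τ : ℝ} (hC : 0 ≤ C) (hC' : 0 ≤ C')
    (hs : s ≤ 1) (hs' : s' ≤ 1) (hK : 0 ≤ K) (hP : MassBound P s C) (hQ : MassBound Q s' C')
    (hτ : 1 - s / 2 - s' / 2 < τ)
    (hS : ∀ ξ, ‖measureFourier S ξ‖ ≤ K * (1 + |ξ|) ^ (-τ)) :
    Integrable fun ξ => measureFourier P ξ * measureFourier Q ξ * measureFourier S ξ := by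
  have hc : Continuous fun ξ => measureFourier P ξ * measureFourier Q ξ * measureFourier S ξ :=
    ((continuous_measureFourier P).mul (continuous_measureFourier Q)).mul
      (continuous_measureFourier S)
  -- The surplus in `τ` is shared equally, so that each energy weight exceeds its critical exponent
  -- by `e` and the half-weights multiply to `(1 + |ξ|)^(-τ)`.
  set e := τ - (1 - s / 2 - s' / 2) with he
  have h1 := hP.integrable_sq_measureFourier_mul_rpow hC (q := 1 - s + e) (by linarith) (by linarith)
  have h2 := hQ.integrable_sq_measureFourier_mul_rpow hC' (q := 1 - s' + e) (by linarith)
    (by linarith)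
  refine Integrable.mono' ((h1.add h2).const_mul K) hc.aestronglyMeasurable (ae_of_all _ fun ξ => ?_)
  rw [norm_mul, norm_mul, Pi.add_apply]
  have hsq : ∀ q : ℝ, (1 + |ξ|) ^ (-q) = ((1 + |ξ|) ^ (-q / 2)) ^ 2 := by
    intro q
    rw [← Real.rpow_natCast, ← Real.rpow_mul (by positivity)]
    congr 1; push_cast; ring
  have hprod : (1 + |ξ|) ^ (-τ) = (1 + |ξ|) ^ (-(1 - s + e) / 2) * (1 + |ξ|) ^ (-(1 - s' + e) / 2) := by
    rw [← Real.rpow_add (by positivity)]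
    congr 1; rw [he]; ring
  rw [hsq, hsq]
  set x := (1 + |ξ|) ^ (-(1 - s + e) / 2) with hx
  set y := (1 + |ξ|) ^ (-(1 - s' + e) / 2) with hy
  have hx0 : 0 ≤ x := by positivity
  have hy0 : 0 ≤ y := by positivity
  have hS' := hS ξ
  rw [hprod] at hS'
  set a := ‖measureFourier P ξ‖
  set b := ‖measureFourier Q ξ‖
  have ha : 0 ≤ a := norm_nonneg _
  have hb : 0 ≤ b := norm_nonneg _
  calc a * b * ‖measureFourier S ξ‖ ≤ a * b * (K * (x * y)) := by gcongr
    _ = K * ((a * x) * (b * y)) := by ring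
    _ ≤ K * (a ^ 2 * x ^ 2 + b ^ 2 * y ^ 2) := by
      gcongr
      nlinarith [sq_nonneg (a * x - b * y), mul_nonneg (mul_nonneg ha hx0) (mul_nonneg hb hy0)]

end Convolution

theorem theorem4 (μ ν γ : Measure ℝ)
    (hμ : IsSelfSimilarMeasure μ) (hν : IsSelfSimilarMeasure ν) (hγ : IsSelfSimilarMeasure γ)
    (hμ_reg : IsADRegular μ) (hν_reg : IsADRegular ν) (hγ_reg : IsADRegular γ)
    (hμ_pos : μ.support ⊆ Set.Ioi 0) (hν_pos : ν.support ⊆ Set.Ioi 0)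
    (hγ_pos : γ.support ⊆ Set.Ioi 0) :
    (kappaTwo μ * kappaTwo ν +
        max ((3 / 2 : ℝ) * kappaTwo μ + kappaTwo ν) ((3 / 2 : ℝ) * kappaTwo ν + kappaTwo μ)
          > (5 / 2 : ℝ) →
      ∃ g : ℝ → ℝ, (∀ x, 0 ≤ g x) ∧ MemLp g 2 volume ∧
        Measure.mconv μ ν = volume.withDensity (fun x => ENNReal.ofReal (g x))) ∧
    (kappaTwo μ / 2 + kappaTwo ν / 2 +
        (kappaTwo γ - 1 / 2) / (kappaTwo γ + 3 / 2) > (1 : ℝ) →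
      ∃ g : ℝ → ℝ, (∀ x, 0 ≤ g x) ∧ Continuous g ∧
        Measure.mconv (Measure.mconv μ ν) γ =
          volume.withDensity (fun x => ENNReal.ofReal (g x))) := by
  have pμ : IsProbabilityMeasure μ := hμ.1
  have pν : IsProbabilityMeasure ν := hν.1
  have pγ : IsProbabilityMeasure γ := hγ.1
  obtain ⟨m₁, M₁, hm₁, hmM₁, hs₁⟩ := hμ.exists_ae_mem_Icc hμ_pos
  obtain ⟨m₂, M₂, hm₂, hmM₂, hs₂⟩ := hν.exists_ae_mem_Icc hν_pos
  obtain ⟨m₃, M₃, hm₃, hmM₃, hs₃⟩ := hγ.exists_ae_mem_Icc hγ_pos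
  obtain ⟨C₁, hC₁, hb₁⟩ := hμ_reg.exists_massBound
  obtain ⟨C₂, hC₂, hb₂⟩ := hν_reg.exists_massBound
  obtain ⟨C₃, hC₃, hb₃⟩ := hγ_reg.exists_massBound
  have hL₁ := hb₁.map_log hm₁ hmM₁ hs₁
  have hL₂ := hb₂.map_log hm₂ hmM₂ hs₂
  have hD₁ : 0 ≤ C₁ * (2 * M₁) ^ kappaTwo μ :=
    mul_nonneg hC₁ (Real.rpow_nonneg (by linarith) _)
  have hD₂ : 0 ≤ C₂ * (2 * M₂) ^ kappaTwo ν :=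
    mul_nonneg hC₂ (Real.rpow_nonneg (by linarith) _)
  have hs₁₂ := ae_mem_Icc_mconv hm₁ hm₂ hs₁ hs₂
  have hF₁₂ := measureFourier_map_log_mconv hm₁ hm₂ hs₁ hs₂
  have p₁₂ : IsProbabilityMeasure (Measure.mconv μ ν) :=
    Measure.isProbabilityMeasure_map (by fun_prop)
  -- Here `a` is the dimension of the factor used for pointwise decay and `b` that of the factor
  -- used for energy. The hypothesis is `(1 - b)/2 < (a - 1/2)/(a + 3/2)` with denominators cleared.
  have exponent : ∀ a b : ℝ, 0 ≤ a → b ≤ 1 → 5 / 2 < a * b + (3 / 2 * b + a) →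
      ∃ τ, 0 < τ ∧ 1 - b < 2 * τ ∧ τ * (a + 3 / 2) < a - 1 / 2 := by
    intro a b ha hb hab
    have : (1 - b) / 2 < (a - 1 / 2) / (a + 3 / 2) := by
      rw [lt_div_iff₀ (by linarith)]; nlinarith
    obtain ⟨τ, h1, h2⟩ := exists_between this
    exact ⟨τ, by linarith, by linarith, (lt_div_iff₀ (by linarith)).1 h2⟩
  constructor
  · intro hcond
    refine exists_memLp_two_density_of_measureFourier_map_log (mul_pos hm₁ hm₂) hs₁₂ ?_
    rw [funext hF₁₂]
    rcases max_cases ((3 / 2 : ℝ) * kappaTwo μ + kappaTwo ν)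
      ((3 / 2 : ℝ) * kappaTwo ν + kappaTwo μ) with ⟨hmax, -⟩ | ⟨hmax, -⟩
    · rw [hmax] at hcond
      -- The factor with coefficient `3/2` in the maximum supplies the energy bound; the other
      -- supplies the pointwise decay.
      obtain ⟨τ, h0, h1, h2⟩ := exponent (kappaTwo ν) (kappaTwo μ) (kappaTwo_nonneg ν)
        (kappaTwo_le_one μ) (by linarith)
      obtain ⟨K, -, hK⟩ := hν.exists_norm_measureFourier_map_log_le_rpow (kappaTwo_nonneg ν)
        (kappaTwo_le_one ν) hC₂ hb₂ hm₂ hmM₂ hs₂ h0 h2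
      simp_rw [mul_comm (measureFourier (μ.map Real.log) _)]
      exact memLp_two_mul_measureFourier hD₁ hL₁ h0.le h1 hK
    · rw [hmax] at hcond
      obtain ⟨τ, h0, h1, h2⟩ := exponent (kappaTwo μ) (kappaTwo ν) (kappaTwo_nonneg μ)
        (kappaTwo_le_one ν) (by linarith)
      obtain ⟨K, -, hK⟩ := hμ.exists_norm_measureFourier_map_log_le_rpow (kappaTwo_nonneg μ)
        (kappaTwo_le_one μ) hC₁ hb₁ hm₁ hmM₁ hs₁ h0 h2
      exact memLp_two_mul_measureFourier hD₂ hL₂ h0.le h1 hK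
  · intro hcond
    have p₁₂₃ : IsProbabilityMeasure (Measure.mconv (Measure.mconv μ ν) γ) :=
      Measure.isProbabilityMeasure_map (by fun_prop)
    refine exists_continuous_density_of_measureFourier_map_log
      (mul_pos (mul_pos hm₁ hm₂) hm₃) (ae_mem_Icc_mconv (mul_pos hm₁ hm₂) hm₃ hs₁₂ hs₃) ?_
    rw [funext (measureFourier_map_log_mconv (mul_pos hm₁ hm₂) hm₃ hs₁₂ hs₃)]
    simp_rw [hF₁₂]
    have hlt : 1 - kappaTwo μ / 2 - kappaTwo ν / 2
        < (kappaTwo γ - 1 / 2) / (kappaTwo γ + 3 / 2) := by linarith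
    obtain ⟨τ, h1, h2⟩ := exists_between hlt
    have h0 : 0 < τ := by linarith [kappaTwo_le_one μ, kappaTwo_le_one ν]
    obtain ⟨K, hK0, hK⟩ := hγ.exists_norm_measureFourier_map_log_le_rpow (kappaTwo_nonneg γ)
      (kappaTwo_le_one γ) hC₃ hb₃ hm₃ hmM₃ hs₃ h0
      ((lt_div_iff₀ (by linarith [kappaTwo_nonneg γ])).1 h2)
    exact integrable_mul_mul_measureFourier hD₁ hD₂ (kappaTwo_le_one μ) (kappaTwo_le_one ν) hK0
      hL₁ hL₂ h1 hK
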